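/- **Theorem.** All Hilbert spaces are complex and finite dimensional, and $L(V)$ is the space of linear maps $V\to V$. *Data.* * $\mathbf Q$ is the symmetric monoidal category whose objects are the finite families $(V_i)_{i\in I}$ of Hilbert spaces, and whose morphisms $(V_j)_{j\in J}\to(W_i)_{i\in I}$ are the matrices $(F_{ij})$ of completely positive maps $F_{ij}:L(V_j)\to L(W_i)$ which are trace non-increasing: $\sum_i\operatorname{tr}F_{ij}(\rho)\le\operatorname{tr}\rho$ for all $j$ and all positive $\rho\in L(V_j)$. Composition is matrix multiplication, and $(V_i)_{i}\otimes(W_j)_{j}=(V_i\otimes W_j)_{(i,j)}$, with structure maps inherited from Hilbert spaces. $\mathbf Q'_s$ is the category whose objects are the Hilbert spaces, and whose morphisms $V\to W$ are the completely positive trace preserving maps $L(V)\to L(W)$. It is included in $\mathbf Q$ by one-term families. * $K$ is the discrete category of Hilbert spaces, and $\mathrm{Fwm}(K)$ is the free affine monoidal category on $K$. Its objects are the finite sequences $(V_i)_{i\in[n]}$ of objects of $K$; a morphism $(V_i)_{i\in[n]}\to(W_i)_{i\in[m]}$ is an injection $\varphi:[m]\to[n]$ together with morphisms $V_{\varphi(i)}\to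 W_i$ of $K$; the tensor product is concatenation, and the unit is the empty sequence. * For a category $\mathcal C$, the free finite coproduct completion $\mathcal C^+$ has as objects the finite families $(V_a)_{a\in A}$ of objects of $\mathcal C$; a morphism $(V_a)_{a\in A}\to(W_b)_{b\in B}$ is a function $\varphi:A\to B$ together with morphisms $V_a\to W_{\varphi(a)}$. If $\mathcal C$ is symmetric monoidal, then so is $\mathcal C^+$, with $(V_a)_a\otimes(W_b)_b=(V_a\otimes W_b)_{(a,b)}$. Put $\mathbf Q''=(\mathrm{Fwm}(K))^+$. * $\Phi:\mathbf{FinSet}\to\mathbf Q''$ sends a set $A$ to the family $(I)_{a\in A}$ that is constant at the tensor unit $I$ of $\mathrm{Fwm}(K)$, and sends a function $\varphi$ to $\varphi$ together with identities. * $\hat F:\mathrm{Fwm}(K)\to\mathbf Q'_s$ sends a sequence to the tensor product of its terms, and a morphism with underlying injection $\varphi$ to the map that traces out the factors not in the image of $\varphi$ and permutes the others according to $\varphi$. * $\Psi:\mathbf Q''\to\mathbf Q$ is the finite coproduct preserving extension of $\mathrm{Fwm}(K)\xrightarrow{\hat F}\mathbf Q'_s\hookrightarrow\mathbf Q$. Explicitly,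 it sends $(X_a)_{a\in A}$ to $(\hat F X_a)_{a\in A}$. * $\Gamma$ is the class of all finite product cones in $\mathbf Q^{op}$. *Claim.* The functor $\hat F$ extends, up to natural isomorphism, the identity-on-objects functor $K\to\mathbf Q'_s$, and its composite with $\mathbf Q'_s\hookrightarrow\mathbf Q$ is strong symmetric monoidal; the restriction of $\Psi$ to $\mathrm{Fwm}(K)$ is naturally isomorphic to that composite. The data $\mathcal B=\mathbf{FinSet}$, $\mathcal C=\mathbf Q''$, $\mathcal D=\mathbf Q$, $\Phi$, $\Psi$, $\Gamma$ satisfy all the hypotheses of the theorem on abstract models of the quantum lambda calculus, namely: 1. $\mathcal B$ has finite products (and is regarded as a symmetric monoidal category through them), and $\mathcal C$ and $\mathcal D$ are symmetric monoidal; 2. $\mathcal B$, $\mathcal C$ and $\mathcal D$ have finite coproducts, and in each of them the tensor product preserves finite coproducts in each variable; 3. $\mathcal C$ is affine, i.e. its tensor unit is terminal; 4. $\Phi$ and $\Psi$ are strong symmetric monoidal, with respect to the cartesian product on $\mathcal B$; 5. $\Phi$ and $\Psi$ preserve finite coproducts; 6. $\Phi$ is full and faithful; 7. $\Psi$ is essentially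 surjective on objects; 8. there is an isomorphism $\mathcal C(\Phi b,c)\times\mathcal C(\Phi b,c')\cong\mathcal C(\Phi b,c\otimes c')$, natural in $b\in\mathcal B$ and $c,c'\in\mathcal C$; 9. $\Gamma$ is preserved by the opposite of the tensor functor of $\mathcal D$: for each $d\in\mathcal D$, the functors $(d\otimes-)^{op}$ and $(-\otimes d)^{op}$ on $\mathcal D^{op}$ send cones in $\Gamma$ to cones in $\Gamma$; 10. $\Gamma$ contains all the finite product cones of $\mathcal D^{op}$. -/

import Mathlib

open CategoryTheory CategoryTheory.Limits

noncomputable section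

namespace QModel

open scoped TensorProduct

/-- A finite dimensional Hilbert space, i.e. a finite dimensional complex inner product space. -/
structure FdHilb where
  carrier : Type
  [normed : NormedAddCommGroup carrier]
  [inner : InnerProductSpace ℂ carrier]
  [findim : FiniteDimensional ℂ carrier]

namespace FdHilb

instance : CoeSort FdHilb Type := ⟨FdHilb.carrier⟩

attribute [instance] FdHilb.normed FdHilb.inner FdHilb.findim

/-- The tensor product of Hilbert spaces. -/
abbrev tensor (V W : FdHilb) : FdHilb := ⟨V ⊗[ℂ] W⟩

/-- The one-dimensional Hilbert space `ℂ`. -/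
abbrev unit : FdHilb := ⟨ℂ⟩

/-- The space `L(V)` of linear maps `V → V`. -/
abbrev L (V : FdHilb) : Type := V →ₗ[ℂ] V

/-- The trace on `L(V)`. -/
abbrev tr (V : FdHilb) : L V →ₗ[ℂ] ℂ := LinearMap.trace ℂ V

/-- The operator `u ρ u⁻¹ = u ρ u†` for a unitary `u`. -/
def conjU {V W : FdHilb} (u : V ≃ₗᵢ[ℂ] W) : L V →ₗ[ℂ] L W := u.toLinearEquiv.conj.toLinearMap

/-- The element `A ⊗ B` of `L(V ⊗ W)`. -/
def opTensor {V W : FdHilb} (A : L V) (B : L W) : L (tensor V W) := TensorProduct.map A B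

end FdHilb

open FdHilb

/-- Complete positivity: `F(ρ) = ∑ᵢ Fᵢ ρ Fᵢ†` for finitely many linear maps `Fᵢ : V → W`. -/
def IsCP {V W : FdHilb} (F : L V →ₗ[ℂ] L W) : Prop :=
  ∃ (m : ℕ) (K : Fin m → (V →ₗ[ℂ] W)), ∀ ρ : L V, F ρ = ∑ i, K i ∘ₗ ρ ∘ₗ (K i).adjoint

/-- The tensor product of `f : L(V) → L(X)` and `g : L(W) → L(Y)`, through the canonical
isomorphisms `L(V ⊗ W) ≅ L(V) ⊗ L(W)`. -/
def mapTensor {V W X Y : FdHilb} (f : L V →ₗ[ℂ] L X) (g : L W →ₗ[ℂ] L Y) :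
    L (tensor V W) →ₗ[ℂ] L (tensor X Y) :=
  (homTensorHomEquiv ℂ X Y X Y).toLinearMap ∘ₗ TensorProduct.map f g ∘ₗ
    (homTensorHomEquiv ℂ V W V W).symm.toLinearMap

section CP

variable {V W X Y : FdHilb}

lemma mapTensor_opTensor (f : L V →ₗ[ℂ] L X) (g : L W →ₗ[ℂ] L Y) (A : L V) (B : L W) :
    mapTensor f g (opTensor A B) = opTensor (f A) (g B) := by
  have h : (homTensorHomEquiv ℂ V W V W).symm (TensorProduct.map A B) = A ⊗ₜ B := by
    rw [LinearEquiv.symm_apply_eq, homTensorHomEquiv_apply]; rfl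
  simp only [mapTensor, opTensor, LinearMap.comp_apply, LinearEquiv.coe_coe]
  erw [h]
  rw [TensorProduct.map_tmul, homTensorHomEquiv_apply]; rfl

/-- `opTensor` as a bilinear map. -/
def opTensorB (V W : FdHilb) : L V →ₗ[ℂ] L W →ₗ[ℂ] L (tensor V W) :=
  TensorProduct.homTensorHomMap (.id ℂ) V W V W |> TensorProduct.curry

lemma opTensorB_apply (A : L V) (B : L W) : opTensorB V W A B = opTensor A B := rfl

lemma tensor_ext {M : Type*} [AddCommMonoid M] [Module ℂ M] {S T : L (tensor V W) →ₗ[ℂ] M}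
    (h : ∀ A B, S (opTensor A B) = T (opTensor A B)) : S = T := by
  have : S ∘ₗ (homTensorHomEquiv ℂ V W V W).toLinearMap =
      T ∘ₗ (homTensorHomEquiv ℂ V W V W).toLinearMap := by
    apply TensorProduct.ext'
    intro A B
    have := h A B
    simp only [LinearMap.comp_apply, LinearEquiv.coe_coe, homTensorHomEquiv_apply]
    exact this
  ext1 ρ
  have := congrArg (fun f => f ((homTensorHomEquiv ℂ V W V W).symm ρ)) this
  simpa only [LinearMap.comp_apply, LinearEquiv.coe_coe, LinearEquiv.apply_symm_apply] using this

lemma sum_comp {κ : Type*} (s : Finset κ) (f : κ → (W →ₗ[ℂ] X)) (g : V →ₗ[ℂ] W) :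
    (∑ i ∈ s, f i) ∘ₗ g = ∑ i ∈ s, f i ∘ₗ g := by
  ext x; simp

lemma comp_sum {κ : Type*} (s : Finset κ) (f : κ → (V →ₗ[ℂ] W)) (g : W →ₗ[ℂ] X) :
    g ∘ₗ (∑ i ∈ s, f i) = ∑ i ∈ s, g ∘ₗ f i := by
  ext x; simp

lemma IsCP.of_fintype {κ : Type*} [Fintype κ] {F : L V →ₗ[ℂ] L W} (K : κ → (V →ₗ[ℂ] W))
    (h : ∀ ρ, F ρ = ∑ i, K i ∘ₗ ρ ∘ₗ (K i).adjoint) : IsCP F :=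
  ⟨Fintype.card κ, fun i => K ((Fintype.equivFin κ).symm i), fun ρ => by
    rw [h ρ]; exact (Equiv.sum_comp (Fintype.equivFin κ).symm
      (fun i => K i ∘ₗ ρ ∘ₗ (K i).adjoint)).symm⟩

lemma IsCP.zero : IsCP (0 : L V →ₗ[ℂ] L W) := ⟨0, Fin.elim0, fun ρ => by simp⟩

lemma IsCP.id : IsCP (LinearMap.id : L V →ₗ[ℂ] L V) :=
  IsCP.of_fintype (κ := Unit) (fun _ => LinearMap.id) fun ρ => by
    simp [show LinearMap.adjoint (LinearMap.id : V →ₗ[ℂ] V) = LinearMap.id from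
      LinearMap.adjoint_id]

lemma IsCP.add {f g : L V →ₗ[ℂ] L W} (hf : IsCP f) (hg : IsCP g) : IsCP (f + g) := by
  obtain ⟨m, K, hK⟩ := hf
  obtain ⟨n, K', hK'⟩ := hg
  exact IsCP.of_fintype (Sum.elim K K') fun ρ => by simp [hK, hK']

lemma IsCP.sum {κ : Type*} (s : Finset κ) {f : κ → (L V →ₗ[ℂ] L W)} (hf : ∀ i, IsCP (f i)) :
    IsCP (∑ i ∈ s, f i) := by
  classical
  induction s using Finset.induction_on with
  | empty => simpa using IsCP.zero
  | insert a s ha ih => rw [Finset.sum_insert ha]; exact (hf a).add ih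

lemma IsCP.comp {f : L V →ₗ[ℂ] L W} {g : L W →ₗ[ℂ] L X} (hg : IsCP g) (hf : IsCP f) :
    IsCP (g ∘ₗ f) := by
  obtain ⟨m, K, hK⟩ := hf
  obtain ⟨n, K', hK'⟩ := hg
  refine IsCP.of_fintype (fun p : Fin n × Fin m => K' p.1 ∘ₗ K p.2) fun ρ => ?_
  rw [Fintype.sum_prod_type]
  simp [hK, hK', LinearMap.adjoint_comp, sum_comp, comp_sum,
    LinearMap.comp_assoc]

lemma IsCP.conjU (u : V ≃ₗᵢ[ℂ] W) : IsCP (FdHilb.conjU u) :=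
  IsCP.of_fintype (κ := Unit) (fun _ => u.toLinearEquiv.toLinearMap) fun ρ => by
    have : LinearMap.adjoint u.toLinearEquiv.toLinearMap = u.symm.toLinearEquiv.toLinearMap := by
      symm
      rw [LinearMap.eq_adjoint_iff]
      intro x y
      have := u.inner_map_map (u.symm x) y
      simpa using this.symm
    simp only [Finset.univ_unique, Finset.sum_singleton, this]
    rfl

lemma IsCP.mapTensor {f : L V →ₗ[ℂ] L X} {g : L W →ₗ[ℂ] L Y} (hf : IsCP f) (hg : IsCP g) :
    IsCP (mapTensor f g) := by
  obtain ⟨m, K, hK⟩ := hf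
  obtain ⟨n, K', hK'⟩ := hg
  let KK : Fin m × Fin n → ((tensor V W) →ₗ[ℂ] (tensor X Y)) :=
    fun p => TensorProduct.map (K p.1) (K' p.2)
  have hKK : ∀ p, (KK p).adjoint = TensorProduct.map (K p.1).adjoint (K' p.2).adjoint :=
    fun p => TensorProduct.adjoint_map _ _
  refine IsCP.of_fintype KK fun ρ => ?_
  have : QModel.mapTensor f g = ∑ p, (LinearMap.llcomp ℂ _ _ _ (KK p)) ∘ₗ
      (LinearMap.lcomp ℂ _ (KK p).adjoint) := by
    apply tensor_ext
    intro A B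
    rw [mapTensor_opTensor, hK, hK', ← opTensorB_apply]
    simp only [map_sum, LinearMap.sum_apply, Fintype.sum_prod_type, LinearMap.comp_apply]
    rw [Finset.sum_comm]
    refine Finset.sum_congr rfl fun i _ => Finset.sum_congr rfl fun j _ => ?_
    rw [opTensorB_apply, LinearMap.lcomp_apply', LinearMap.llcomp_apply', hKK]
    simp only [opTensor, KK]
    erw [← TensorProduct.map_comp, ← TensorProduct.map_comp]
  rw [this]
  simp [LinearMap.sum_apply, LinearMap.lcomp_apply', LinearMap.llcomp_apply']

lemma trace_opTensor (A : L V) (B : L W) : tr _ (opTensor A B) = tr V A * tr W B :=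
  LinearMap.trace_tensorProduct' A B

lemma trace_conjU (u : V ≃ₗᵢ[ℂ] W) (ρ : L V) : tr W (FdHilb.conjU u ρ) = tr V ρ :=
  LinearMap.trace_conj' ρ u.toLinearEquiv

lemma conjU_apply (u : V ≃ₗᵢ[ℂ] W) (ρ : L V) (w : W) :
    FdHilb.conjU u ρ w = u (ρ (u.symm w)) := rfl

/-- The operator `|v⟩⟨w|`. -/
def ketbra (v : V) (w : W) : W →ₗ[ℂ] V := (InnerProductSpace.rankOne ℂ v w).toLinearMap

lemma ketbra_apply (v : V) (w x : W) : ketbra v w x = inner ℂ w x • v := rfl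

lemma trace_ketbra (v w : V) : tr V (ketbra v w) = inner ℂ w v :=
  InnerProductSpace.trace_rankOne v w

lemma conj_ketbra (K : V →ₗ[ℂ] W) (v w : V) :
    K ∘ₗ ketbra v w ∘ₗ K.adjoint = ketbra (K v) (K w) := by
  ext x
  simp [ketbra_apply, LinearMap.adjoint_inner_right]

lemma isPositive_ketbra (v : V) : (ketbra v v).IsPositive :=
  (InnerProductSpace.isPositive_rankOne_self v).toLinearMap

lemma IsPositive.eq_sum {A : L V} (hA : A.IsPositive) :
    ∃ (m : ℕ) (u : Fin m → V), A = ∑ i, ketbra (u i) (u i) := by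
  have := FiniteDimensional.complete ℂ V
  obtain ⟨m, u, h⟩ := (ContinuousLinearMap.isPositive_iff_eq_sum_rankOne
    (T := A.toContinuousLinearMap)).1 ((LinearMap.isPositive_toContinuousLinearMap_iff A).2 hA)
  refine ⟨m, u, ?_⟩
  ext x
  have := congrArg (fun T => T x) h
  simpa [ketbra_apply] using this

lemma trace_comp_nonneg {A ρ : L V} (hA : A.IsPositive) (hρ : ρ.IsPositive) :
    0 ≤ (tr V (A ∘ₗ ρ)).re := by
  obtain ⟨m, u, rfl⟩ := IsPositive.eq_sum hρ
  have : ∀ v : V, A ∘ₗ ketbra v v = ketbra (A v) v := fun v => by ext x; simp [ketbra_apply]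
  simp only [comp_sum, map_sum, this, trace_ketbra, Complex.re_sum]
  exact Finset.sum_nonneg fun i _ => hA.re_inner_nonneg_right _

lemma opTensor_ketbra (v v' : V) (w w' : W) :
    opTensor (ketbra v v') (ketbra w w') =
      ketbra (V := tensor V W) (W := tensor V W) (v ⊗ₜ w) (v' ⊗ₜ w') := by
  apply TensorProduct.ext'
  intro x y
  have : inner ℂ (v' ⊗ₜ[ℂ] w') (x ⊗ₜ[ℂ] y) = inner ℂ v' x * inner ℂ w' y :=
    TensorProduct.inner_tmul ..
  rw [opTensor, TensorProduct.map_tmul, ketbra_apply, ketbra_apply, ketbra_apply, this,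
    TensorProduct.smul_tmul_smul]

lemma isPositive_opTensor {A : L V} {B : L W} (hA : A.IsPositive) (hB : B.IsPositive) :
    (opTensor A B).IsPositive := by
  obtain ⟨m, u, rfl⟩ := IsPositive.eq_sum hA
  obtain ⟨n, v, rfl⟩ := IsPositive.eq_sum hB
  rw [← opTensorB_apply]
  simp only [map_sum, LinearMap.sum_apply, opTensorB_apply, opTensor_ketbra]
  exact LinearMap.isPositive_sum _ fun i _ => LinearMap.isPositive_sum _ fun j _ =>
    isPositive_ketbra _

lemma IsCP.isPositive {F : L V →ₗ[ℂ] L W} (hF : IsCP F) {ρ : L V} (hρ : ρ.IsPositive) :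
    (F ρ).IsPositive := by
  obtain ⟨m, K, hK⟩ := hF
  rw [hK]
  exact LinearMap.isPositive_sum _ fun i _ => hρ.conj_adjoint _

lemma exists_density {κ : Type*} [Fintype κ] {W : κ → FdHilb} (f : ∀ i, L V →ₗ[ℂ] L (W i))
    (hf : ∀ i, IsCP (f i)) :
    ∃ P : L V, P.IsPositive ∧ ∀ ρ, ∑ i, tr (W i) (f i ρ) = tr V (P ∘ₗ ρ) := by
  choose m K hK using hf
  refine ⟨∑ i, ∑ k, (K i k).adjoint ∘ₗ K i k, LinearMap.isPositive_sum _ fun i _ =>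
    LinearMap.isPositive_sum _ fun k _ => LinearMap.isPositive_adjoint_comp_self _, fun ρ => ?_⟩
  simp only [hK, map_sum, sum_comp]
  refine Finset.sum_congr rfl fun i _ => Finset.sum_congr rfl fun k _ => ?_
  rw [← LinearMap.comp_assoc, LinearMap.trace_comp_comm', LinearMap.comp_assoc]

lemma one_sub_isPositive {P : L V} (hP : P.IsPositive)
    (h : ∀ ρ : L V, ρ.IsPositive → (tr V (P ∘ₗ ρ)).re ≤ (tr V ρ).re) :
    (LinearMap.id - P).IsPositive := by
  refine ⟨LinearMap.IsSymmetric.id.sub hP.isSymmetric, fun x => ?_⟩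
  have := h _ (isPositive_ketbra x)
  have h2 : P ∘ₗ ketbra x x = ketbra (P x) x := by ext y; simp [ketbra_apply]
  rw [h2, trace_ketbra, trace_ketbra] at this
  rw [LinearMap.sub_apply, inner_sub_left, LinearMap.id_apply, map_sub, sub_nonneg]
  rwa [← hP.isSymmetric x x] at this

lemma trace_mapTensor_le {κ κ' : Type*} [Fintype κ] [Fintype κ'] {X : κ → FdHilb}
    {Y : κ' → FdHilb} (f : ∀ i, L V →ₗ[ℂ] L (X i)) (g : ∀ i, L W →ₗ[ℂ] L (Y i))
    (hf : ∀ i, IsCP (f i)) (hg : ∀ i, IsCP (g i))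
    (hf' : ∀ ρ : L V, ρ.IsPositive → ∑ i, (tr _ (f i ρ)).re ≤ (tr V ρ).re)
    (hg' : ∀ ρ : L W, ρ.IsPositive → ∑ i, (tr _ (g i ρ)).re ≤ (tr W ρ).re)
    (ρ : L (tensor V W)) (hρ : ρ.IsPositive) :
    ∑ p : κ × κ', (tr _ (mapTensor (f p.1) (g p.2) ρ)).re ≤ (tr _ ρ).re := by
  obtain ⟨P, hP, hfP⟩ := exists_density f hf
  obtain ⟨R, hR, hgR⟩ := exists_density g hg
  have h1 : ∑ p : κ × κ', tr _ ∘ₗ mapTensor (f p.1) (g p.2) =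
      tr _ ∘ₗ LinearMap.llcomp ℂ _ _ _ (opTensor P R) := by
    apply tensor_ext
    intro A B
    have : opTensor P R ∘ₗ opTensor A B = opTensor (P ∘ₗ A) (R ∘ₗ B) :=
      (TensorProduct.map_comp _ _ _ _).symm
    simp only [LinearMap.sum_apply, LinearMap.comp_apply, mapTensor_opTensor, trace_opTensor,
      LinearMap.llcomp_apply', this, Fintype.sum_prod_type]
    rw [← hfP, ← hgR, Finset.sum_mul_sum]
  have h2 := congrArg (fun S => (S ρ).re) h1
  simp only [LinearMap.sum_apply, LinearMap.comp_apply, Complex.re_sum,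
    LinearMap.llcomp_apply'] at h2
  rw [h2]
  have hP1 := one_sub_isPositive hP fun ρ hρ => by
    rw [← hfP, Complex.re_sum]; exact hf' ρ hρ
  have hR1 := one_sub_isPositive hR fun ρ hρ => by
    rw [← hgR, Complex.re_sum]; exact hg' ρ hρ
  have h3 : LinearMap.id - opTensor P R =
      opTensor (LinearMap.id - P) LinearMap.id + opTensor P (LinearMap.id - R) := by
    have : opTensor (LinearMap.id : L V) (LinearMap.id : L W) = LinearMap.id :=
      TensorProduct.map_id
    rw [← this]
    simp only [← opTensorB_apply, map_sub, LinearMap.sub_apply]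
    abel
  have h4 := trace_comp_nonneg ((isPositive_opTensor hP1 LinearMap.isPositive_id).add
    (isPositive_opTensor hP hR1)) hρ
  rw [← h3, LinearMap.sub_comp, map_sub, Complex.sub_re, LinearMap.id_comp] at h4
  linarith

end CP

end QModel

namespace QModel

open scoped TensorProduct
open FdHilb

/-- An object `(V_i)_{i ∈ I}` of the category `Q`: a finite family of finite dimensional Hilbert
spaces. -/
structure Q where
  idx : Type
  [fin : Fintype idx]
  sp : idx → FdHilb

attribute [instance] Q.fin

namespace Q

/-- A trace non-increasing superoperator `(V_j)_j → (W_i)_i`: a matrix of completely positive maps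
`F_{ij} : L(V_j) → L(W_i)` with `∑ᵢ tr (F_{ij} ρ) ≤ tr ρ` for all `j` and all positive `ρ`. (These
traces are real numbers, since completely positive maps preserve positivity.) -/
@[ext]
structure Hom (X Y : Q) where
  entry : ∀ (i : Y.idx) (j : X.idx), L (X.sp j) →ₗ[ℂ] L (Y.sp i)
  cp : ∀ i j, IsCP (entry i j)
  trace_le : ∀ (j : X.idx) (ρ : L (X.sp j)), ρ.IsPositive →
    ∑ i, (tr _ (entry i j ρ)).re ≤ (tr _ ρ).re

/-- The space `⨁ᵢ L(V_i)`. -/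
abbrev Alg (X : Q) : Type := ∀ i : X.idx, L (X.sp i)

/-- The `(i, j)`-entry of the identity matrix: the identity if `i = j`, and zero otherwise. -/
def delta (X : Q) (i j : X.idx) : L (X.sp j) →ₗ[ℂ] L (X.sp i) :=
  letI := Classical.decEq X.idx
  LinearMap.proj i ∘ₗ LinearMap.single ℂ (fun i => L (X.sp i)) j

variable {X Y Z W : Q}

lemma delta_self (i : X.idx) : delta X i i = LinearMap.id := by
  ext1 ρ; simp [delta]

lemma delta_ne {i j : X.idx} (h : i ≠ j) : delta X i j = 0 := by
  ext1 ρ; simp [delta, h]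

lemma isCP_delta (i j : X.idx) : IsCP (delta X i j) := by
  by_cases h : i = j
  · subst h; rw [delta_self]; exact IsCP.id
  · rw [delta_ne h]; exact IsCP.zero

lemma sum_delta_apply (a : Alg X) (i : X.idx) : ∑ j, delta X i j (a j) = a i := by
  rw [Finset.sum_eq_single i]
  · rw [delta_self]; rfl
  · intro j _ hj; rw [delta_ne hj.symm]; rfl
  · simp

/-- The linear map `⨁ⱼ L(V_j) → ⨁ᵢ L(W_i)` given by a matrix. -/
def Hom.toLin (f : Hom X Y) : Alg X →ₗ[ℂ] Alg Y :=
  LinearMap.pi fun i => ∑ j, f.entry i j ∘ₗ LinearMap.proj j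

lemma Hom.toLin_apply (f : Hom X Y) (a : Alg X) (i : Y.idx) :
    f.toLin a i = ∑ j, f.entry i j (a j) := by
  simp [Hom.toLin]

lemma Hom.entry_apply (f : Hom X Y) (i : Y.idx) (j : X.idx) (ρ : L (X.sp j)) :
    f.entry i j ρ = f.toLin (fun k => delta X k j ρ) i := by
  rw [Hom.toLin_apply, Finset.sum_eq_single j]
  · rw [delta_self]; rfl
  · intro k _ hk; rw [delta_ne hk]; simp
  · simp

lemma Hom.ext_lin {f g : Hom X Y} (h : ∀ a, f.toLin a = g.toLin a) : f = g := by
  ext i j ρ : 4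
  rw [Hom.entry_apply, Hom.entry_apply, h]

/-- Composition is matrix multiplication. -/
instance : Category Q where
  Hom := Hom
  id X :=
    { entry := delta X
      cp := isCP_delta
      trace_le := fun j ρ _ => by
        rw [Finset.sum_eq_single j]
        · rw [delta_self]; rfl
        · intro i _ hi; rw [delta_ne hi]; simp
        · simp }
  comp {X Y Z} f g :=
    { entry := fun i j => ∑ k, g.entry i k ∘ₗ f.entry k j
      cp := fun i j => IsCP.sum _ fun k => (g.cp i k).comp (f.cp k j)
      trace_le := fun j ρ hρ => by
        refine le_trans ?_ (f.trace_le j ρ hρ)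
        simp only [LinearMap.sum_apply, map_sum, Complex.re_sum, LinearMap.comp_apply]
        rw [Finset.sum_comm]
        exact Finset.sum_le_sum fun k _ => g.trace_le k _ ((f.cp k j).isPositive hρ) }
  id_comp f := by
    refine Hom.ext (funext fun i => funext fun j => ?_)
    dsimp only
    rw [Finset.sum_eq_single j]
    · rw [delta_self]; rfl
    · intro k _ hk; rw [delta_ne hk]; ext1; simp
    · simp
  comp_id f := by
    refine Hom.ext (funext fun i => funext fun j => ?_)
    dsimp only
    rw [Finset.sum_eq_single i]
    · rw [delta_self]; rfl
    · intro k _ hk; rw [delta_ne hk.symm]; ext1; simp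
    · simp
  assoc f g h := by
    refine Hom.ext (funext fun i => funext fun j => LinearMap.ext fun ρ => ?_)
    simp only [LinearMap.sum_apply, LinearMap.comp_apply, map_sum]
    exact Finset.sum_comm

/-- The linear map `⨁ⱼ L(V_j) → ⨁ᵢ L(W_i)` given by a morphism of `Q`. -/
def lin (f : X ⟶ Y) : Alg X →ₗ[ℂ] Alg Y := Hom.toLin f

lemma hom_ext {f g : X ⟶ Y} (h : ∀ a, lin f a = lin g a) : f = g := Hom.ext_lin h

@[simp] lemma lin_id (X : Q) (a : Alg X) : lin (𝟙 X) a = a := by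
  ext1 i
  exact (Hom.toLin_apply _ _ _).trans (sum_delta_apply a i)

@[simp] lemma lin_comp (f : X ⟶ Y) (g : Y ⟶ Z) (a : Alg X) :
    lin (f ≫ g) a = lin g (lin f a) := by
  ext1 i
  refine (Hom.toLin_apply _ _ _).trans (Eq.trans ?_ (Hom.toLin_apply _ _ _).symm)
  have : ∀ k, lin f a k = ∑ j, Hom.entry f k j (a j) := fun k => Hom.toLin_apply _ _ _
  simp only [this, map_sum]
  rw [Finset.sum_comm]
  refine Finset.sum_congr rfl fun j _ => ?_
  exact LinearMap.sum_apply _ _ _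

/-- The tensor product `(V_i)_{i ∈ I} ⊗ (W_j)_{j ∈ J} = (V_i ⊗ W_j)_{(i, j) ∈ I × J}`. -/
abbrev tensorObj (X Y : Q) : Q := ⟨X.idx × Y.idx, fun p => tensor (X.sp p.1) (Y.sp p.2)⟩

/-- The unit of the tensor product: the one-term family `ℂ`. -/
abbrev tensorUnit : Q := ⟨Unit, fun _ => FdHilb.unit⟩

/-- The tensor product of matrices of completely positive maps,
`(f ⊗ g)_{(i, k), (j, l)} = f_{ij} ⊗ g_{kl}`. -/
def tensorHom {X X' Y Y' : Q} (f : X ⟶ X') (g : Y ⟶ Y') : tensorObj X Y ⟶ tensorObj X' Y' :=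
  show Hom (tensorObj X Y) (tensorObj X' Y') from
  { entry := fun p q => mapTensor (Hom.entry f p.1 q.1) (Hom.entry g p.2 q.2)
    cp := fun p q => (Hom.cp f p.1 q.1).mapTensor (Hom.cp g p.2 q.2)
    trace_le := fun q ρ hρ => trace_mapTensor_le (fun i => Hom.entry f i q.1)
      (fun i => Hom.entry g i q.2) (fun i => Hom.cp f i q.1) (fun i => Hom.cp g i q.2)
      (Hom.trace_le f q.1) (Hom.trace_le g q.2) ρ hρ }

/-- The elements `(a_i ⊗ b_j)_{(i, j)}`. -/
def box (a : Alg X) (b : Alg Y) : Alg (tensorObj X Y) := fun p => opTensor (a p.1) (b p.2)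

/-- `box` as a bilinear map. -/
def boxB (X Y : Q) : Alg X →ₗ[ℂ] Alg Y →ₗ[ℂ] Alg (tensorObj X Y) :=
  LinearMap.mk₂ ℂ box
    (fun a a' b => funext fun p => by simp [box, ← opTensorB_apply])
    (fun c a b => funext fun p => by simp [box, ← opTensorB_apply])
    (fun a b b' => funext fun p => by simp [box, ← opTensorB_apply])
    (fun c a b => funext fun p => by simp [box, ← opTensorB_apply])

lemma boxB_apply (a : Alg X) (b : Alg Y) : boxB X Y a b = box a b := rfl

lemma box_ext {M : Type*} [AddCommMonoid M] [Module ℂ M] {S T : Alg (tensorObj X Y) →ₗ[ℂ] M}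
    (h : ∀ a b, S (box a b) = T (box a b)) : S = T := by
  classical
  apply LinearMap.pi_ext'
  rintro ⟨i, j⟩
  apply tensor_ext
  intro A B
  have : LinearMap.single ℂ (fun p => L ((tensorObj X Y).sp p)) (i, j) (opTensor A B) =
      box (Pi.single i A) (Pi.single j B) := by
    ext1 ⟨k, l⟩
    by_cases hk : k = i
    · subst hk
      by_cases hl : l = j
      · subst hl; simp [box]
      · have : (k, l) ≠ (k, j) := by simp [hl]
        simp [box, this, hl, ← opTensorB_apply]
    · have : (k, l) ≠ (i, j) := by simp [hk]
      simp [box, this, hk, ← opTensorB_apply]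
  simp only [LinearMap.comp_apply, this, h]

lemma hom_ext₂ {f g : tensorObj X Y ⟶ Z} (h : ∀ a b, lin f (box a b) = lin g (box a b)) :
    f = g :=
  hom_ext fun a => congrArg (fun S => S a) (box_ext (S := lin f) (T := lin g) h)

lemma hom_ext₃ {f g : tensorObj (tensorObj X Y) Z ⟶ W}
    (h : ∀ a b c, lin f (box (box a b) c) = lin g (box (box a b) c)) : f = g :=
  hom_ext₂ fun x c => congrArg (fun S => S x)
    (box_ext (S := lin f ∘ₗ (boxB _ Z).flip c) (T := lin g ∘ₗ (boxB _ Z).flip c) fun a b => h a b c)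

lemma hom_ext₃' {f g : tensorObj X (tensorObj Y Z) ⟶ W}
    (h : ∀ a b c, lin f (box a (box b c)) = lin g (box a (box b c))) : f = g :=
  hom_ext₂ fun a x => congrArg (fun S => S x)
    (box_ext (S := lin f ∘ₗ (boxB X _) a) (T := lin g ∘ₗ (boxB X _) a) fun b c => h a b c)

lemma hom_ext₄ {V : Q} {f g : tensorObj (tensorObj (tensorObj X Y) Z) W ⟶ V}
    (h : ∀ a b c d, lin f (box (box (box a b) c) d) = lin g (box (box (box a b) c) d)) :
    f = g :=
  hom_ext₃ fun x c d => congrArg (fun S => S x)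
    (box_ext (S := lin f ∘ₗ (boxB _ W).flip d ∘ₗ (boxB _ Z).flip c)
      (T := lin g ∘ₗ (boxB _ W).flip d ∘ₗ (boxB _ Z).flip c) fun a b => h a b c d)

@[simp] lemma lin_tensorHom {X X' Y Y' : Q} (f : X ⟶ X') (g : Y ⟶ Y') (a : Alg X) (b : Alg Y) :
    lin (tensorHom f g) (box a b) = box (lin f a) (lin g b) := by
  ext1 p
  refine (Hom.toLin_apply _ _ _).trans ?_
  have hf : lin f a p.1 = ∑ j, Hom.entry f p.1 j (a j) := Hom.toLin_apply _ _ _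
  have hg : lin g b p.2 = ∑ j, Hom.entry g p.2 j (b j) := Hom.toLin_apply _ _ _
  rw [Fintype.sum_prod_type, box, hf, hg, ← opTensorB_apply]
  simp only [map_sum, LinearMap.sum_apply]
  rw [Finset.sum_comm]
  refine Finset.sum_congr rfl fun i _ => Finset.sum_congr rfl fun j _ => ?_
  exact mapTensor_opTensor _ _ _ _

/-- The morphism `(V_j)_{j ∈ J} → (W_i)_{i ∈ I}` given by an injection `e : I → J` and unitaries
`u_i : V_{e(i)} → W_i`, with value `(u_i a_{e(i)} u_i†)_i` at `(a_j)_j`. -/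
def reindex {X Y : Q} (e : Y.idx → X.idx) (he : Function.Injective e)
    (u : ∀ i, X.sp (e i) ≃ₗᵢ[ℂ] Y.sp i) : X ⟶ Y :=
  show Hom X Y from
  { entry := fun i j => conjU (u i) ∘ₗ delta X (e i) j
    cp := fun i j => (IsCP.conjU _).comp (isCP_delta _ _)
    trace_le := fun j ρ hρ => by
      simp only [LinearMap.comp_apply, trace_conjU]
      by_cases h : ∃ i, e i = j
      · obtain ⟨i, rfl⟩ := h
        rw [Finset.sum_eq_single i]
        · rw [delta_self]; rfl
        · intro k _ hk; rw [delta_ne (he.ne hk)]; simp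
        · simp
      · rw [Finset.sum_eq_zero]
        · exact (Complex.nonneg_iff.1 hρ.trace_nonneg).1
        · intro i _; rw [delta_ne fun hi => h ⟨i, hi⟩]; simp }

@[simp] lemma lin_reindex (e : Y.idx → X.idx) (he : Function.Injective e)
    (u : ∀ i, X.sp (e i) ≃ₗᵢ[ℂ] Y.sp i) (a : Alg X) (i : Y.idx) :
    lin (reindex e he u) a i = conjU (u i) (a (e i)) := by
  refine (Hom.toLin_apply _ _ _).trans ?_
  have : ∀ j, (Hom.entry (reindex e he u)) i j (a j) = conjU (u i) (delta X (e i) j (a j)) :=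
    fun j => rfl
  simp only [this, ← map_sum]
  rw [sum_delta_apply]

/-- The associativity isomorphism, given by the one of Hilbert spaces. -/
def assocHom (X Y Z : Q) : tensorObj (tensorObj X Y) Z ⟶ tensorObj X (tensorObj Y Z) :=
  reindex (fun p => ((p.1, p.2.1), p.2.2)) (fun p q h => by
    simp only [Prod.mk.injEq] at h; ext <;> simp [h])
    fun p => TensorProduct.assocIsometry ℂ (X.sp p.1) (Y.sp p.2.1) (Z.sp p.2.2)

/-- The inverse of the associativity isomorphism. -/
def assocInv (X Y Z : Q) : tensorObj X (tensorObj Y Z) ⟶ tensorObj (tensorObj X Y) Z :=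
  reindex (fun p => (p.1.1, (p.1.2, p.2))) (fun p q h => by
    simp only [Prod.mk.injEq] at h; ext <;> simp [h])
    fun p => (TensorProduct.assocIsometry ℂ (X.sp p.1.1) (Y.sp p.1.2) (Z.sp p.2)).symm

/-- The left unit isomorphism, given by the one of Hilbert spaces. -/
def leftHom (X : Q) : tensorObj tensorUnit X ⟶ X :=
  reindex (fun i => ((), i)) (fun i j h => by simpa using h)
    fun i => TensorProduct.lidIsometry ℂ (X.sp i)

/-- The inverse of the left unit isomorphism. -/
def leftInv (X : Q) : X ⟶ tensorObj tensorUnit X :=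
  reindex (fun p => p.2) (fun _ _ h => by ext; exact h)
    fun p => (TensorProduct.lidIsometry ℂ (X.sp p.2)).symm

/-- The right unit isomorphism, given by the one of Hilbert spaces. -/
def rightHom (X : Q) : tensorObj X tensorUnit ⟶ X :=
  reindex (fun i => (i, ())) (fun i j h => by simpa using h)
    fun i => TensorProduct.ridIsometry ℂ (X.sp i)

/-- The inverse of the right unit isomorphism. -/
def rightInv (X : Q) : X ⟶ tensorObj X tensorUnit :=
  reindex (fun p => p.1) (fun _ _ h => Prod.ext h rfl)
    fun p => (TensorProduct.ridIsometry ℂ (X.sp p.1)).symm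

/-- The symmetry, given by the one of Hilbert spaces. -/
def braidHom (X Y : Q) : tensorObj X Y ⟶ tensorObj Y X :=
  reindex (fun p => (p.2, p.1)) (fun p q h => by
    simp only [Prod.mk.injEq] at h; ext <;> simp [h])
    fun p => TensorProduct.commIsometry ℂ (X.sp p.2) (Y.sp p.1)

@[simp] lemma lin_assocHom (a : Alg X) (b : Alg Y) (c : Alg Z) :
    lin (assocHom X Y Z) (box (box a b) c) = box a (box b c) := by
  ext1 p
  refine (lin_reindex _ _ _ _ _).trans ?_
  apply TensorProduct.ext_threefold'
  intro x y z
  rfl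

@[simp] lemma lin_assocInv (a : Alg X) (b : Alg Y) (c : Alg Z) :
    lin (assocInv X Y Z) (box a (box b c)) = box (box a b) c := by
  ext1 p
  refine (lin_reindex _ _ _ _ _).trans ?_
  apply TensorProduct.ext_threefold
  intro x y z
  rfl

@[simp] lemma lin_braidHom (a : Alg X) (b : Alg Y) :
    lin (braidHom X Y) (box a b) = box b a := by
  ext1 p
  refine (lin_reindex _ _ _ _ _).trans ?_
  apply TensorProduct.ext'
  intro x y
  rfl

@[simp] lemma lin_leftHom (s : Alg tensorUnit) (a : Alg X) :
    lin (leftHom X) (box s a) = (s () (1 : ℂ) : ℂ) • a := by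
  ext1 i
  refine (lin_reindex _ _ _ _ _).trans ?_
  ext x
  rfl

@[simp] lemma lin_rightHom (s : Alg tensorUnit) (a : Alg X) :
    lin (rightHom X) (box a s) = (s () (1 : ℂ) : ℂ) • a := by
  ext1 i
  refine (lin_reindex _ _ _ _ _).trans ?_
  ext x
  rfl

lemma conjU_symm {V W : FdHilb} (u : V ≃ₗᵢ[ℂ] W) (A : L V) :
    conjU u.symm (conjU u A) = A := by
  ext x; simp [conjU_apply]

lemma conjU_symm' {V W : FdHilb} (u : V ≃ₗᵢ[ℂ] W) (A : L W) :
    conjU u (conjU u.symm A) = A := by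
  ext x; simp [conjU_apply]

instance : MonoidalCategoryStruct Q where
  tensorObj := tensorObj
  whiskerLeft X _ _ f := tensorHom (𝟙 X) f
  whiskerRight f Y := tensorHom f (𝟙 Y)
  tensorHom := tensorHom
  tensorUnit := tensorUnit
  associator X Y Z :=
    { hom := assocHom X Y Z
      inv := assocInv X Y Z
      hom_inv_id := hom_ext₃ fun a b c => by simp
      inv_hom_id := hom_ext₃' fun a b c => by simp }
  leftUnitor X :=
    { hom := leftHom X
      inv := leftInv X
      hom_inv_id := hom_ext fun a => by
        ext1 p
        rw [lin_comp, lin_id]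
        exact (lin_reindex _ _ _ _ _).trans
          ((congrArg (conjU _) (lin_reindex _ _ _ _ _)).trans (conjU_symm _ _))
      inv_hom_id := hom_ext fun a => by
        ext1 p
        rw [lin_comp, lin_id]
        exact (lin_reindex _ _ _ _ _).trans
          ((congrArg (conjU _) (lin_reindex _ _ _ _ _)).trans (conjU_symm' _ _)) }
  rightUnitor X :=
    { hom := rightHom X
      inv := rightInv X
      hom_inv_id := hom_ext fun a => by
        ext1 p
        rw [lin_comp, lin_id]
        exact (lin_reindex _ _ _ _ _).trans
          ((congrArg (conjU _) (lin_reindex _ _ _ _ _)).trans (conjU_symm _ _))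
      inv_hom_id := hom_ext fun a => by
        ext1 p
        rw [lin_comp, lin_id]
        exact (lin_reindex _ _ _ _ _).trans
          ((congrArg (conjU _) (lin_reindex _ _ _ _ _)).trans (conjU_symm' _ _)) }

instance : MonoidalCategory Q :=
  MonoidalCategory.ofTensorHom
    (id_tensorHom_id := fun X Y => hom_ext₂ (f := tensorHom (𝟙 X) (𝟙 Y)) (g := 𝟙 (tensorObj X Y))
      fun a b => by simp)
    (id_tensorHom := fun _ _ _ _ => rfl)
    (tensorHom_id := fun _ _ => rfl)
    (tensorHom_comp_tensorHom := fun f f' g g' => hom_ext₂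
      (f := tensorHom f f' ≫ tensorHom g g') (g := tensorHom (f ≫ g) (f' ≫ g'))
      fun a b => by simp)
    (associator_naturality := fun f g h => hom_ext₃
      (f := tensorHom (tensorHom f g) h ≫ assocHom _ _ _)
      (g := assocHom _ _ _ ≫ tensorHom f (tensorHom g h)) fun a b c => by simp)
    (leftUnitor_naturality := fun f => hom_ext₂
      (f := tensorHom (𝟙 _) f ≫ leftHom _) (g := leftHom _ ≫ f) fun a b => by simp)
    (rightUnitor_naturality := fun f => hom_ext₂
      (f := tensorHom f (𝟙 _) ≫ rightHom _) (g := rightHom _ ≫ f) fun a b => by simp)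
    (pentagon := fun W X Y Z => hom_ext₄
      (f := tensorHom (assocHom W X Y) (𝟙 Z) ≫ assocHom W (tensorObj X Y) Z ≫
        tensorHom (𝟙 W) (assocHom X Y Z))
      (g := assocHom (tensorObj W X) Y Z ≫ assocHom W X (tensorObj Y Z))
      fun a b c d => by simp)
    (triangle := fun X Y => hom_ext₃
      (f := assocHom X tensorUnit Y ≫ tensorHom (𝟙 X) (leftHom Y))
      (g := tensorHom (rightHom X) (𝟙 Y)) fun a b c => by
        have h : ∀ (t : ℂ) (x : Alg X) (y : Alg Y), box x (t • y) = box (t • x) y :=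
          fun t x y => by simp [← boxB_apply]
        simp [h])

instance : SymmetricCategory Q where
  braiding X Y :=
    { hom := braidHom X Y
      inv := braidHom Y X
      hom_inv_id := hom_ext₂ (f := braidHom X Y ≫ braidHom Y X) (g := 𝟙 (tensorObj X Y))
        fun a b => by simp
      inv_hom_id := hom_ext₂ (f := braidHom Y X ≫ braidHom X Y) (g := 𝟙 (tensorObj Y X))
        fun a b => by simp }
  braiding_naturality_right X _ _ f := hom_ext₂
    (f := tensorHom (𝟙 X) f ≫ braidHom _ _) (g := braidHom _ _ ≫ tensorHom f (𝟙 X))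
    fun a b => by simp
  braiding_naturality_left f X := hom_ext₂
    (f := tensorHom f (𝟙 X) ≫ braidHom _ _) (g := braidHom _ _ ≫ tensorHom (𝟙 X) f)
    fun a b => by simp
  hexagon_forward X Y Z := hom_ext₃
    (f := assocHom X Y Z ≫ braidHom X (tensorObj Y Z) ≫ assocHom Y Z X)
    (g := tensorHom (braidHom X Y) (𝟙 Z) ≫ assocHom Y X Z ≫ tensorHom (𝟙 Y) (braidHom X Z))
    fun a b c => by simp
  hexagon_reverse X Y Z := hom_ext₃'
    (f := assocInv X Y Z ≫ braidHom (tensorObj X Y) Z ≫ assocInv Z X Y)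
    (g := tensorHom (𝟙 X) (braidHom Y Z) ≫ assocInv X Z Y ≫ tensorHom (braidHom X Z) (𝟙 Y))
    fun a b c => by simp
  symmetry X Y := hom_ext₂ (f := braidHom X Y ≫ braidHom Y X) (g := 𝟙 (tensorObj X Y))
        fun a b => by simp

end Q

end QModel

namespace QModel

open MonoidalCategory

/-- An object of the free affine monoidal category on `K`: a finite sequence of objects of `K`. -/
structure Fwm (K : Type*) where
  len : ℕ
  obj : Fin len → K

namespace Fwm

/-- A morphism `(V_i)_{i ∈ [n]} → (W_i)_{i ∈ [m]}`: an injection `φ : [m] → [n]` and morphisms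
`V_{φ(i)} → W_i` of `K`. -/
structure Hom {K : Type*} [Category K] (X Y : Fwm K) where
  map : Fin Y.len ↪ Fin X.len
  app : ∀ i, X.obj (map i) ⟶ Y.obj i

instance {K : Type*} [Category K] : Category (Fwm K) where
  Hom := Hom
  id _ := ⟨Function.Embedding.refl _, fun _ => 𝟙 _⟩
  comp f g := ⟨g.map.trans f.map, fun i => f.app (g.map i) ≫ g.app i⟩
  id_comp f := congrArg (Hom.mk f.map) (funext fun _ => Category.id_comp _)
  comp_id f := congrArg (Hom.mk f.map) (funext fun _ => Category.comp_id _)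
  assoc _ _ _ := congrArg (Hom.mk _) (funext fun _ => Category.assoc _ _ _)

/-- The canonical inclusion of `K`, by one-term sequences. -/
def incl (K : Type*) [Category K] : K ⥤ Fwm K where
  obj V := ⟨1, fun _ => V⟩
  map {V W} f := (⟨Function.Embedding.refl _, fun _ => f⟩ :
    Hom (⟨1, fun _ => V⟩ : Fwm K) ⟨1, fun _ => W⟩)
  map_id _ := rfl
  map_comp _ _ := rfl

variable {α : Type*}

lemma hom_ext {X Y : Fwm (Discrete α)} {f g : X ⟶ Y} (h : ∀ i, f.map i = g.map i) : f = g := by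
  obtain ⟨f, F⟩ := f
  obtain ⟨g, G⟩ := g
  obtain rfl : f = g := by ext i : 1; exact h i
  exact congrArg (Hom.mk f) (funext fun _ => Subsingleton.elim _ _)

lemma obj_map {X Y : Fwm (Discrete α)} (f : X ⟶ Y) (i : Fin Y.len) :
    X.obj (f.map i) = Y.obj i := Discrete.ext (Discrete.eq_of_hom (f.app i))

/-- A morphism of sequences of objects of a discrete category, given by a compatible injection. -/
def homMk {X Y : Fwm (Discrete α)} (φ : Fin Y.len ↪ Fin X.len) (h : ∀ i, X.obj (φ i) = Y.obj i) :
    X ⟶ Y := (⟨φ, fun i => eqToHom (h i)⟩ : Hom X Y)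

@[simp] lemma homMk_map {X Y : Fwm (Discrete α)} (φ : Fin Y.len ↪ Fin X.len)
    (h : ∀ i, X.obj (φ i) = Y.obj i) : (homMk φ h).map = φ := rfl

@[simp] lemma id_map (X : Fwm (Discrete α)) (i) : (𝟙 X : X ⟶ X).map i = i := rfl

@[simp] lemma comp_map {X Y Z : Fwm (Discrete α)} (f : X ⟶ Y) (g : Y ⟶ Z) (i) :
    (f ≫ g).map i = f.map (g.map i) := rfl

/-- An isomorphism given by a compatible bijection. -/
def isoMk {X Y : Fwm (Discrete α)} (e : Fin Y.len ≃ Fin X.len) (h : ∀ i, X.obj (e i) = Y.obj i) :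
    X ≅ Y where
  hom := homMk e.toEmbedding h
  inv := homMk e.symm.toEmbedding fun i => by rw [← h]; simp
  hom_inv_id := hom_ext fun i => by simp
  inv_hom_id := hom_ext fun i => by simp

/-- The tensor product is the concatenation of sequences. -/
abbrev tensorObj (X Y : Fwm (Discrete α)) : Fwm (Discrete α) :=
  ⟨X.len + Y.len, Fin.append X.obj Y.obj⟩

/-- The disjoint union of two injections. -/
def sumMap {m n m' n' : ℕ} (f : Fin m ↪ Fin n) (g : Fin m' ↪ Fin n') :
    Fin (m + m') ↪ Fin (n + n') :=
  finSumFinEquiv.symm.toEmbedding.trans ((f.sumMap g).trans finSumFinEquiv.toEmbedding)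

@[simp] lemma sumMap_castAdd {m n m' n' : ℕ} (f : Fin m ↪ Fin n) (g : Fin m' ↪ Fin n')
    (i : Fin m) : sumMap f g (Fin.castAdd m' i) = Fin.castAdd n' (f i) := by
  simp [sumMap]

@[simp] lemma sumMap_natAdd {m n m' n' : ℕ} (f : Fin m ↪ Fin n) (g : Fin m' ↪ Fin n')
    (i : Fin m') : sumMap f g (Fin.natAdd m i) = Fin.natAdd n (g i) := by
  simp [sumMap]

@[simp] lemma cast_castAdd' {a b c : ℕ} (h : a + (b + c) = a + b + c) (i : Fin a) :
    (i.castAdd (b + c)).cast h = (i.castAdd b).castAdd c := rfl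

@[simp] lemma cast_natAdd_castAdd {a b c : ℕ} (h : a + (b + c) = a + b + c) (i : Fin b) :
    ((i.castAdd c).natAdd a).cast h = (i.natAdd a).castAdd c := rfl

@[simp] lemma cast_natAdd_natAdd {a b c : ℕ} (h : a + (b + c) = a + b + c) (i : Fin c) :
    ((i.natAdd b).natAdd a).cast h = i.natAdd (a + b) := Fin.ext (Nat.add_assoc _ _ _).symm

@[simp] lemma cast_castAdd_castAdd {a b c : ℕ} (h : a + b + c = a + (b + c)) (i : Fin a) :
    ((i.castAdd b).castAdd c).cast h = i.castAdd (b + c) := rfl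

@[simp] lemma cast_castAdd_natAdd {a b c : ℕ} (h : a + b + c = a + (b + c)) (i : Fin b) :
    ((i.natAdd a).castAdd c).cast h = (i.castAdd c).natAdd a := rfl

@[simp] lemma cast_natAdd' {a b c : ℕ} (h : a + b + c = a + (b + c)) (i : Fin c) :
    (i.natAdd (a + b)).cast h = (i.natAdd b).natAdd a := Fin.ext (Nat.add_assoc _ _ _)

section raw
variable {a b c d a' b' c' a'' b'' : ℕ}

lemma sumMap_refl (i : Fin (a + b)) :
    sumMap (Function.Embedding.refl (Fin a)) (Function.Embedding.refl (Fin b)) i = i := by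
  refine Fin.addCases (fun i => ?_) (fun i => ?_) i <;> simp

lemma sumMap_sumMap (f : Fin a' ↪ Fin a) (g : Fin b' ↪ Fin b) (f' : Fin a'' ↪ Fin a')
    (g' : Fin b'' ↪ Fin b') (i : Fin (a'' + b'')) :
    sumMap f g (sumMap f' g' i) = sumMap (f'.trans f) (g'.trans g) i := by
  refine Fin.addCases (fun i => ?_) (fun i => ?_) i <;> simp

/-- The canonical bijection of the associativity isomorphism. -/
def assocE (a b c : ℕ) : Fin (a + (b + c)) ≃ Fin (a + b + c) :=
  finCongr (Nat.add_assoc _ _ _).symm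

@[simp] lemma assocE_apply (i) : assocE a b c i = i.cast (Nat.add_assoc _ _ _).symm := rfl

@[simp] lemma assocE_symm_apply (i) : (assocE a b c).symm i = i.cast (Nat.add_assoc _ _ _) := rfl

lemma sumMap_assoc (f : Fin a' ↪ Fin a) (g : Fin b' ↪ Fin b) (h : Fin c' ↪ Fin c)
    (i : Fin (a' + (b' + c'))) :
    sumMap (sumMap f g) h (assocE _ _ _ i) = assocE _ _ _ (sumMap f (sumMap g h) i) := by
  refine Fin.addCases (fun i => ?_) (fun i => ?_) i
  · simp
  · refine Fin.addCases (fun i => ?_) (fun i => ?_) i <;> simp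

lemma sumMap_left (f : Fin a' ↪ Fin a) (i : Fin a') :
    sumMap (Function.Embedding.refl (Fin 0)) f (finCongr (Nat.zero_add _).symm i) =
      finCongr (Nat.zero_add _).symm (f i) := by
  have h {n : ℕ} (i : Fin n) : finCongr (Nat.zero_add n).symm i = Fin.natAdd 0 i :=
    Fin.ext (Nat.zero_add _).symm
  rw [h, h, sumMap_natAdd]

lemma sumMap_pentagon (i : Fin (a + (b + (c + d)))) :
    sumMap (assocE a b c).toEmbedding (Function.Embedding.refl (Fin d))
      (assocE a (b + c) d (sumMap (Function.Embedding.refl (Fin a)) (assocE b c d).toEmbedding i)) =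
    assocE (a + b) c d (assocE a b (c + d) i) := by
  refine Fin.addCases (fun i => ?_) (fun i => ?_) i
  · simp
  · refine Fin.addCases (fun i => ?_) (fun i => ?_) i
    · simp
    · refine Fin.addCases (fun i => ?_) (fun i => ?_) i <;> simp

lemma sumMap_triangle (i : Fin (a + b)) :
    assocE a 0 b (sumMap (Function.Embedding.refl (Fin a))
      (finCongr (Nat.zero_add b).symm).toEmbedding i) =
    sumMap (finCongr (Nat.add_zero a).symm).toEmbedding (Function.Embedding.refl (Fin b)) i := by
  refine Fin.addCases (fun i => ?_) (fun i => ?_) i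
  · simp; rfl
  · rw [sumMap_natAdd, sumMap_natAdd]
    rfl

lemma sumMap_flip (f : Fin a' ↪ Fin a) (g : Fin b' ↪ Fin b) (i : Fin (b' + a')) :
    sumMap f g (finAddFlip i) = finAddFlip (sumMap g f i) := by
  refine Fin.addCases (fun i => ?_) (fun i => ?_) i <;> simp

lemma sumMap_hexagon (i : Fin (b + (c + a))) :
    assocE a b c (finAddFlip (assocE b c a i)) =
      sumMap (finAddFlip (m := b) (n := a)).toEmbedding (Function.Embedding.refl (Fin c))
        (assocE b a c (sumMap (Function.Embedding.refl (Fin b))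
          (finAddFlip (m := c) (n := a)).toEmbedding i)) := by
  refine Fin.addCases (fun i => ?_) (fun i => ?_) i
  · simp
  · refine Fin.addCases (fun i => ?_) (fun i => ?_) i <;> simp

lemma sumMap_hexagon' (i : Fin (c + a + b)) :
    (assocE a b c).symm (finAddFlip ((assocE c a b).symm i)) =
      sumMap (Function.Embedding.refl (Fin a)) (finAddFlip (m := c) (n := b)).toEmbedding
        ((assocE a c b).symm (sumMap (finAddFlip (m := c) (n := a)).toEmbedding
          (Function.Embedding.refl (Fin b)) i)) := by
  refine Fin.addCases (fun i => ?_) (fun i => ?_) i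
  · refine Fin.addCases (fun i => ?_) (fun i => ?_) i <;> simp
  · simp

lemma flip_flip (i : Fin (a + b)) : finAddFlip (finAddFlip i) = i := by
  refine Fin.addCases (fun i => ?_) (fun i => ?_) i <;> simp

end raw

/-- The tensor product of morphisms is the disjoint union of injections. -/
def tensorHom {X X' Y Y' : Fwm (Discrete α)} (f : X ⟶ X') (g : Y ⟶ Y') :
    tensorObj X Y ⟶ tensorObj X' Y' :=
  homMk (sumMap f.map g.map) fun i => by
    refine Fin.addCases (fun i => ?_) (fun i => ?_) i
    · simp [obj_map]
    · simp [obj_map]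

instance : MonoidalCategoryStruct (Fwm (Discrete α)) where
  tensorObj := tensorObj
  whiskerLeft X _ _ f := tensorHom (𝟙 X) f
  whiskerRight f Y := tensorHom f (𝟙 Y)
  tensorHom := tensorHom
  tensorUnit := ⟨0, Fin.elim0⟩
  associator X Y Z := isoMk (finCongr (Nat.add_assoc _ _ _).symm) fun i => by
    simp [Fin.append_assoc]
  leftUnitor X := isoMk (finCongr (Nat.zero_add _).symm) fun i => by
    simp [Fin.append_left_nil]
  rightUnitor X := isoMk (finCongr (Nat.add_zero _).symm) fun i => by
    simp [Fin.append_right_nil]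

instance : MonoidalCategory (Fwm (Discrete α)) :=
  MonoidalCategory.ofTensorHom
    (id_tensorHom_id := fun X Y => hom_ext fun i => sumMap_refl (a := X.len) (b := Y.len) i)
    (id_tensorHom := fun _ _ _ _ => rfl)
    (tensorHom_id := fun _ _ => rfl)
    (tensorHom_comp_tensorHom := fun f f' g g' => hom_ext fun i =>
      sumMap_sumMap f.map f'.map g.map g'.map i)
    (associator_naturality := fun f g h => hom_ext fun i => sumMap_assoc f.map g.map h.map i)
    (leftUnitor_naturality := fun f => hom_ext fun i => sumMap_left f.map i)
    (rightUnitor_naturality := fun f => hom_ext fun i => sumMap_castAdd f.map _ i)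
    (pentagon := fun W X Y Z => hom_ext fun i =>
      sumMap_pentagon (a := W.len) (b := X.len) (c := Y.len) (d := Z.len) i)
    (triangle := fun X Y => hom_ext fun i => sumMap_triangle (a := X.len) (b := Y.len) i)

/-- The symmetry exchanges the two parts of a concatenation. -/
def braid (X Y : Fwm (Discrete α)) : X ⊗ Y ≅ Y ⊗ X :=
  isoMk (X := tensorObj X Y) (Y := tensorObj Y X) finAddFlip fun i => by
    refine Fin.addCases (fun i => ?_) (fun i => ?_) i
    · simp
    · simp

instance : SymmetricCategory (Fwm (Discrete α)) where
  braiding := braid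
  braiding_naturality_right X _ _ f := hom_ext fun i => sumMap_flip (𝟙 X : X ⟶ X).map f.map i
  braiding_naturality_left f X := hom_ext fun i => sumMap_flip f.map (𝟙 X : X ⟶ X).map i
  hexagon_forward X Y Z := hom_ext fun i =>
    sumMap_hexagon (a := X.len) (b := Y.len) (c := Z.len) i
  hexagon_reverse X Y Z := hom_ext fun i =>
    sumMap_hexagon' (a := X.len) (b := Y.len) (c := Z.len) i
  symmetry X Y := hom_ext fun i => flip_flip (a := X.len) (b := Y.len) i

end Fwm

end QModel

namespace CategoryTheory.Limits.FormalCoproduct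
open MonoidalCategory
variable {C : Type*} [Category C] [MonoidalCategory C]

/-- The tensor product of formal coproducts, `(X_a)_a ⊗ (Y_b)_b = (X_a ⊗ Y_b)_{(a, b)}`. -/
instance : MonoidalCategoryStruct (FormalCoproduct.{0} C) where
  tensorObj X Y := ⟨X.I × Y.I, fun p => X.obj p.1 ⊗ Y.obj p.2⟩
  whiskerLeft X _ _ f := ⟨fun p => (p.1, f.f p.2), fun p => X.obj p.1 ◁ f.φ p.2⟩
  whiskerRight f Y := ⟨fun p => (f.f p.1, p.2), fun p => f.φ p.1 ▷ Y.obj p.2⟩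
  tensorHom f g := ⟨fun p => (f.f p.1, g.f p.2), fun p => f.φ p.1 ⊗ₘ g.φ p.2⟩
  tensorUnit := ⟨Unit, fun _ => 𝟙_ C⟩
  associator X Y Z :=
    { hom := ⟨fun p => (p.1.1, (p.1.2, p.2)), fun p => (α_ _ _ _).hom⟩
      inv := ⟨fun p => ((p.1, p.2.1), p.2.2), fun p => (α_ _ _ _).inv⟩
      hom_inv_id := hom_ext rfl fun p => by simp
      inv_hom_id := hom_ext rfl fun p => by simp }
  leftUnitor X :=
    { hom := ⟨fun p => p.2, fun p => (λ_ _).hom⟩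
      inv := ⟨fun p => ((), p), fun p => (λ_ _).inv⟩
      hom_inv_id := hom_ext rfl fun p => by simp
      inv_hom_id := hom_ext rfl fun p => by simp }
  rightUnitor X :=
    { hom := ⟨fun p => p.1, fun p => (ρ_ _).hom⟩
      inv := ⟨fun p => (p, ()), fun p => (ρ_ _).inv⟩
      hom_inv_id := hom_ext rfl fun p => by simp
      inv_hom_id := hom_ext rfl fun p => by simp }

instance : MonoidalCategory (FormalCoproduct.{0} C) :=
  MonoidalCategory.ofTensorHom
    (id_tensorHom_id := fun X Y => congrArg (Hom.mk _) (funext fun p =>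
      MonoidalCategory.id_tensorHom_id (X.obj p.1) (Y.obj p.2)))
    (id_tensorHom := fun X _ _ f => congrArg (Hom.mk _) (funext fun p =>
      MonoidalCategory.id_tensorHom (X.obj p.1) (f.φ p.2)))
    (tensorHom_id := fun f Y => congrArg (Hom.mk _) (funext fun p =>
      MonoidalCategory.tensorHom_id (f.φ p.1) (Y.obj p.2)))
    (tensorHom_comp_tensorHom := fun f f' g g' => congrArg (Hom.mk _) (funext fun p =>
      MonoidalCategory.tensorHom_comp_tensorHom (f.φ p.1) (f'.φ p.2) (g.φ _) (g'.φ _)))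
    (associator_naturality := fun f g h => congrArg (Hom.mk _) (funext fun p =>
      MonoidalCategory.associator_naturality (f.φ p.1.1) (g.φ p.1.2) (h.φ p.2)))
    (leftUnitor_naturality := fun f => congrArg (Hom.mk _) (funext fun p =>
      show (𝟙 (𝟙_ C) ⊗ₘ f.φ p.2) ≫ (λ_ _).hom = (λ_ _).hom ≫ f.φ p.2 by simp))
    (rightUnitor_naturality := fun f => congrArg (Hom.mk _) (funext fun p =>
      show (f.φ p.1 ⊗ₘ 𝟙 (𝟙_ C)) ≫ (ρ_ _).hom = (ρ_ _).hom ≫ f.φ p.1 by simp))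
    (pentagon := fun W X Y Z => congrArg (Hom.mk _) (funext fun p =>
      show ((α_ (W.obj p.1.1.1) (X.obj p.1.1.2) (Y.obj p.1.2)).hom ⊗ₘ 𝟙 (Z.obj p.2)) ≫
        (α_ _ _ _).hom ≫ (𝟙 _ ⊗ₘ (α_ _ _ _).hom) = (α_ _ _ _).hom ≫ (α_ _ _ _).hom by simp))
    (triangle := fun X Y => congrArg (Hom.mk _) (funext fun p =>
      show (α_ (X.obj p.1.1) (𝟙_ C) (Y.obj p.2)).hom ≫ (𝟙 _ ⊗ₘ (λ_ _).hom) =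
        (ρ_ _).hom ⊗ₘ 𝟙 _ by simp))

instance [BraidedCategory C] : BraidedCategory (FormalCoproduct.{0} C) where
  braiding X Y :=
    { hom := ⟨fun p => (p.2, p.1), fun p => (β_ _ _).hom⟩
      inv := ⟨fun p => (p.2, p.1), fun p => (β_ _ _).inv⟩
      hom_inv_id := hom_ext rfl fun p => by simp
      inv_hom_id := hom_ext rfl fun p => by simp }
  braiding_naturality_right X _ _ f := congrArg (Hom.mk _) (funext fun p =>
    BraidedCategory.braiding_naturality_right (X.obj p.1) (f.φ p.2))
  braiding_naturality_left f Z := congrArg (Hom.mk _) (funext fun p =>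
    BraidedCategory.braiding_naturality_left (f.φ p.1) (Z.obj p.2))
  hexagon_forward X Y Z := congrArg (Hom.mk _) (funext fun p =>
    BraidedCategory.hexagon_forward (X.obj p.1.1) (Y.obj p.1.2) (Z.obj p.2))
  hexagon_reverse X Y Z := congrArg (Hom.mk _) (funext fun p =>
    BraidedCategory.hexagon_reverse (X.obj p.1) (Y.obj p.2.1) (Z.obj p.2.2))

instance [SymmetricCategory C] : SymmetricCategory (FormalCoproduct.{0} C) where
  symmetry X Y := congrArg (Hom.mk _) (funext fun p =>
    SymmetricCategory.symmetry (X.obj p.1) (Y.obj p.2))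

end CategoryTheory.Limits.FormalCoproduct

namespace QModel
open MonoidalCategory

/-- The property of a family of objects to be finite. -/
def finiteFamily (C : Type*) [Category C] : ObjectProperty (FormalCoproduct.{0} C) :=
  fun X => Finite X.I

/-- The free finite coproduct completion `C⁺`: the finite families of objects of `C`, where a
morphism `(V_a)_{a ∈ A} → (W_b)_{b ∈ B}` is a function `φ : A → B` together with morphisms
`V_a → W_{φ(a)}` of `C`. -/
abbrev FinCoprod (C : Type*) [Category C] := (finiteFamily C).FullSubcategory

instance {C : Type*} [Category C] (X : FinCoprod C) : Finite X.obj.I := X.property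

instance {C : Type*} [Category C] [MonoidalCategory C] : (finiteFamily C).IsMonoidal where
  prop_unit := inferInstanceAs (Finite Unit)
  prop_tensor X Y hX hY :=
    haveI : Finite X.I := hX
    haveI : Finite Y.I := hY
    inferInstanceAs (Finite (X.I × Y.I))

/-- The canonical inclusion of `C` in `C⁺`, by one-term families. -/
def FinCoprod.incl (C : Type*) [Category C] : C ⥤ FinCoprod C :=
  (finiteFamily C).lift (FormalCoproduct.incl C) fun _ => inferInstanceAs (Finite PUnit)

/-- The functor `FinSet → C⁺` which sends a set `A` to the family `(I)_{a ∈ A}` that is constant at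
the tensor unit `I`, and a function `φ` to the morphism given by `φ` and identities. -/
def finSetFunctor (C : Type*) [Category C] [MonoidalCategory C] : FintypeCat.{0} ⥤ FinCoprod C where
  obj A := ⟨⟨A, fun _ => 𝟙_ C⟩, inferInstanceAs (Finite A)⟩
  map φ := ObjectProperty.homMk ⟨φ, fun _ => 𝟙 _⟩
  map_comp f g := by
    apply ObjectProperty.hom_ext
    exact FormalCoproduct.hom_ext rfl fun _ => by simp

/-- The family of finite types is closed under finite limits. -/
lemma closedUnderLimits_finite (J : Type) [SmallCategory J] [Finite J] :
    ObjectProperty.IsClosedUnderLimitsOfShape (C := Type) Finite J where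
  limitsOfShape_le X := by
    rintro ⟨h⟩
    have : ∀ j, Finite (h.diag.obj j) := h.prop_diag_obj
    exact Finite.of_equiv _ (Types.isLimitEquivSections h.isLimit).symm

/-- The cartesian monoidal structure of the category of finite sets. -/
instance : CartesianMonoidalCategory FintypeCat.{0} :=
  haveI := closedUnderLimits_finite (Discrete PEmpty)
  haveI := closedUnderLimits_finite (Discrete WalkingPair)
  CartesianMonoidalCategory.fullSubcategory

instance : BraidedCategory FintypeCat.{0} := .ofCartesianMonoidalCategory

end QModel

namespace QModel

open scoped TensorProduct
open FdHilb MonoidalCategory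

/-- The category `Q'ₛ` of simple trace preserving superoperators; its objects are the finite
dimensional Hilbert spaces. -/
structure QsPrime where
  sp : FdHilb

namespace QsPrime

/-- A trace preserving superoperator `V → W`. -/
@[ext]
structure Hom (V W : QsPrime) where
  map : L V.sp →ₗ[ℂ] L W.sp
  cp : IsCP map
  trace_eq : ∀ ρ : L V.sp, ρ.IsPositive → tr _ (map ρ) = tr _ ρ

instance : Category QsPrime where
  Hom := Hom
  id _ := ⟨LinearMap.id, IsCP.id, fun _ _ => rfl⟩
  comp f g := ⟨g.map ∘ₗ f.map, g.cp.comp f.cp, fun ρ hρ =>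
    (g.trace_eq _ (f.cp.isPositive hρ)).trans (f.trace_eq ρ hρ)⟩

/-- The inclusion functor `Q'ₛ → Qₛ → Q`, by one-term families. -/
def toQ : QsPrime ⥤ Q where
  obj V := ⟨Unit, fun _ => V.sp⟩
  map {V W} f :=
    show Q.Hom ⟨Unit, fun _ => V.sp⟩ ⟨Unit, fun _ => W.sp⟩ from
    { entry := fun _ _ => Hom.map f
      cp := fun _ _ => Hom.cp f
      trace_le := fun _ ρ hρ => by simp [Hom.trace_eq f ρ hρ] }
  map_id V := Q.Hom.ext (funext fun i => funext fun j => (Q.delta_self (X := ⟨Unit, fun _ => V.sp⟩) i).symm)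
  map_comp f g := Q.Hom.ext (funext fun i => funext fun j => (Fintype.sum_unique (ι := Unit) _).symm)

end QsPrime

/-- The family `(G X_a)_a`, for a family `(X_a)_a`. -/
abbrev extendObj {C : Type*} [Category C] (G : C ⥤ QsPrime) (X : FinCoprod C) : Q :=
  { idx := X.obj.I, fin := Fintype.ofFinite _, sp := fun a => (G.obj (X.obj.obj a)).sp }

/-- The functor `C⁺ → Q` induced by a functor `G : C → Q'ₛ`. It sends `(X_a)_a` to `(G X_a)_a`, and
a morphism `(φ, f)` to the matrix whose `(b, a)`-entry is `G f_a` if `φ(a) = b`, and zero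
otherwise; up to isomorphism this is the finite coproduct preserving extension of `G`. -/
def extend {C : Type*} [Category C] (G : C ⥤ QsPrime) : FinCoprod C ⥤ Q where
  obj := extendObj G
  map {X Y} f :=
    show Q.Hom (extendObj G X) (extendObj G Y) from
    { entry := fun b a => Q.delta (extendObj G Y) b (f.hom.f a) ∘ₗ (G.map (f.hom.φ a)).map
      cp := fun b a => (Q.isCP_delta _ _).comp (G.map (f.hom.φ a)).cp
      trace_le := fun a ρ hρ => by
        rw [Finset.sum_eq_single (f.hom.f a)]
        · rw [Q.delta_self]
          exact (congrArg Complex.re ((G.map (f.hom.φ a)).trace_eq ρ hρ)).le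
        · intro b _ hb; rw [Q.delta_ne hb]; simp
        · simp }
  map_id X := Q.Hom.ext (funext fun b => funext fun a => by
    have : (G.map (𝟙 (X.obj.obj a))).map = LinearMap.id := by rw [G.map_id]; rfl
    exact (congrArg (fun T => Q.delta (extendObj G X) b a ∘ₗ T) this).trans (LinearMap.comp_id _))
  map_comp {X Y Z} f g := Q.Hom.ext (funext fun c => funext fun a => by
    refine Eq.trans ?_ (Finset.sum_eq_single (M := L _ →ₗ[ℂ] L _) (f.hom.f a) ?_ ?_).symm
    · have : (G.map (f.hom.φ a ≫ g.hom.φ (f.hom.f a))).map =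
          (G.map (g.hom.φ (f.hom.f a))).map ∘ₗ (G.map (f.hom.φ a)).map := by rw [G.map_comp]; rfl
      dsimp only
      rw [Q.delta_self]
      exact congrArg (fun T => Q.delta (extendObj G Z) c (g.hom.f (f.hom.f a)) ∘ₗ T) this
    · intro b _ hb
      dsimp only
      have : Q.delta (extendObj G Y) b (f.hom.f a) = 0 := Q.delta_ne hb
      rw [this]
      ext1; simp
    · simp)

/-- The tensor product `V_1 ⊗ (V_2 ⊗ ⋯ (V_n ⊗ ℂ))` of a finite sequence of Hilbert spaces. -/
def tens : ∀ {n : ℕ}, (Fin n → FdHilb) → FdHilb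
  | 0, _ => FdHilb.unit
  | _ + 1, V => tensor (V 0) (tens fun i => V i.succ)

/-- The multilinear map `v ↦ v_0 ⊗ t(v_1, …, v_n)`. -/
def tprodSucc {n : ℕ} (V : Fin (n + 1) → FdHilb) (U : FdHilb)
    (t : MultilinearMap ℂ (fun i : Fin n => (V i.succ : Type)) U) :
    MultilinearMap ℂ (fun i => (V i : Type)) (tensor (V 0) U) :=
  LinearMap.uncurryLeft
    { toFun := fun v => (TensorProduct.mk ℂ (V 0) U v).compMultilinearMap t
      map_add' := fun v w => MultilinearMap.ext fun x => TensorProduct.add_tmul v w (t x)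
      map_smul' := fun c v => MultilinearMap.ext fun x => TensorProduct.smul_tmul' c v (t x) }

/-- The elementary tensors `v_1 ⊗ ⋯ ⊗ v_n`. -/
def tprod : ∀ {n : ℕ} (V : Fin n → FdHilb), MultilinearMap ℂ (fun i => (V i : Type)) (tens V)
  | 0, _ => MultilinearMap.constOfIsEmpty ℂ _ (1 : ℂ)
  | _ + 1, V => tprodSucc V (tens fun i => V i.succ) (tprod fun i => V i.succ)

/-- The linear map on `V_0 ⊗ U` induced by a multilinear map, if one on `U` is. -/
def tliftSucc {E : Type} [AddCommGroup E] [Module ℂ E] {n : ℕ} (V : Fin (n + 1) → FdHilb)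
    (U : FdHilb) (l : MultilinearMap ℂ (fun i : Fin n => (V i.succ : Type)) E →ₗ[ℂ] (U →ₗ[ℂ] E)) :
    MultilinearMap ℂ (fun i => (V i : Type)) E →ₗ[ℂ] (tensor (V 0) U →ₗ[ℂ] E) where
  toFun f := TensorProduct.lift (l ∘ₗ f.curryLeft)
  map_add' f g := by
    apply TensorProduct.ext'
    intro x y
    have : (f + g).curryLeft x = f.curryLeft x + g.curryLeft x := rfl
    simp [this]
  map_smul' c f := by
    apply TensorProduct.ext'
    intro x y
    have : (c • f).curryLeft x = c • f.curryLeft x := rfl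
    simp [this]

/-- The linear map on `V_1 ⊗ ⋯ ⊗ V_n` induced by a multilinear map. -/
def tlift {E : Type} [AddCommGroup E] [Module ℂ E] : ∀ {n : ℕ} (V : Fin n → FdHilb),
    MultilinearMap ℂ (fun i => (V i : Type)) E →ₗ[ℂ] (tens V →ₗ[ℂ] E)
  | 0, _ =>
      (LinearMap.ringLmapEquivSelf ℂ ℂ E).symm.toLinearMap ∘ₗ
      { toFun := fun f => f fun i => i.elim0
        map_add' := fun _ _ => rfl
        map_smul' := fun _ _ => rfl }
  | _ + 1, V => tliftSucc V (tens fun i => V i.succ) (tlift fun i => V i.succ)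

lemma tlift_tprod {E : Type} [AddCommGroup E] [Module ℂ E] : ∀ {n : ℕ} (V : Fin n → FdHilb)
    (f : MultilinearMap ℂ (fun i => (V i : Type)) E) (v : ∀ i, V i),
    tlift V f (tprod V v) = f v
  | 0, _, f, v => by
      have : (fun i => i.elim0) = v := funext fun i => i.elim0
      show (1 : ℂ) • f _ = f v
      rw [one_smul, this]
  | _ + 1, V, f, v => by
      show tlift (fun i => V i.succ) (f.curryLeft (v 0)) (tprod _ (Fin.tail v)) = f v
      rw [tlift_tprod, MultilinearMap.curryLeft_apply, Fin.cons_self_tail]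

lemma inner_tprod : ∀ {n : ℕ} (V : Fin n → FdHilb) (v w : ∀ i, V i),
    inner ℂ (tprod V v) (tprod V w) = ∏ i, inner ℂ (v i) (w i)
  | 0, _, v, w => by
      show inner ℂ (1 : ℂ) (1 : ℂ) = _
      simp
  | _ + 1, V, v, w => by
      rw [Fin.prod_univ_succ]
      refine (TensorProduct.inner_tmul (𝕜 := ℂ) (E := V 0) (F := tens fun i => V i.succ) _ _ _ _).trans ?_
      exact congrArg _ (inner_tprod (fun i => V i.succ) (Fin.tail v) (Fin.tail w))

lemma span_tprodSucc {n : ℕ} (V : Fin (n + 1) → FdHilb) (U : FdHilb)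
    (t : MultilinearMap ℂ (fun i : Fin n => (V i.succ : Type)) U)
    (h : Submodule.span ℂ (Set.range t) = ⊤) :
    Submodule.span ℂ (Set.range (tprodSucc V U t)) = ⊤ := by
  rw [eq_top_iff]
  intro x _
  induction x using TensorProduct.induction_on with
  | zero => exact Submodule.zero_mem _
  | add x y hx hy => exact Submodule.add_mem _ (hx trivial) (hy trivial)
  | tmul v y =>
    have hy : y ∈ Submodule.span ℂ (Set.range t) := by rw [h]; trivial
    have := Submodule.mem_map_of_mem (f := TensorProduct.mk ℂ (V 0) U v) hy
    rw [Submodule.map_span] at this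
    refine Submodule.span_mono ?_ this
    rintro _ ⟨_, ⟨w, rfl⟩, rfl⟩
    exact ⟨Fin.cons v w, rfl⟩

lemma span_tprod : ∀ {n : ℕ} (V : Fin n → FdHilb), Submodule.span ℂ (Set.range (tprod V)) = ⊤
  | 0, V => by
      rw [eq_top_iff]
      intro (x : ℂ) _
      have : x = x • (tprod V fun i => i.elim0 : ℂ) := (mul_one x).symm
      rw [this]
      exact Submodule.smul_mem _ _ (Submodule.subset_span ⟨_, rfl⟩)
  | _ + 1, V => span_tprodSucc V _ _ (span_tprod fun i => V i.succ)

lemma eq_sum_ketbra {V : FdHilb} (ρ : L V) :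
    ρ = ∑ i, ketbra (ρ (stdOrthonormalBasis ℂ V i)) (stdOrthonormalBasis ℂ V i) := by
  ext x
  simp only [LinearMap.sum_apply, ketbra_apply, ← map_smul, ← map_sum]
  rw [(stdOrthonormalBasis ℂ V).sum_repr']

lemma ketbra_ext {n : ℕ} {V : Fin n → FdHilb} {M : Type*} [AddCommGroup M] [Module ℂ M]
    {S T : L (tens V) →ₗ[ℂ] M}
    (h : ∀ v w, S (ketbra (tprod V v) (tprod V w)) = T (ketbra (tprod V v) (tprod V w))) :
    S = T := by
  have key : ∀ a b : tens V, S (ketbra a b) = T (ketbra a b) := by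
    intro a b
    have ha : a ∈ Submodule.span ℂ (Set.range (tprod V)) := by rw [span_tprod]; trivial
    have hb : b ∈ Submodule.span ℂ (Set.range (tprod V)) := by rw [span_tprod]; trivial
    induction ha using Submodule.span_induction with
    | mem a ha =>
      obtain ⟨v, rfl⟩ := ha
      induction hb using Submodule.span_induction with
      | mem b hb => obtain ⟨w, rfl⟩ := hb; exact h v w
      | zero => simp [ketbra]
      | add x y _ _ hx hy => simp only [ketbra, map_add] at hx hy ⊢; simp [hx, hy]
      | smul c x _ hx => simp only [ketbra, map_smulₛₗ] at hx ⊢; simp [hx]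
    | zero => simp [ketbra]
    | add x y _ _ hx hy => simp only [ketbra, map_add] at hx hy ⊢; simp [hx, hy]
    | smul c x _ hx => simp only [ketbra, map_smul] at hx ⊢; simp [hx]
  ext1 ρ
  rw [eq_sum_ketbra ρ, map_sum, map_sum]
  exact Finset.sum_congr rfl fun i _ => key _ _

/-- The identification of equal Hilbert spaces. -/
def castEquiv {V W : FdHilb} (h : V = W) : V ≃ₗᵢ[ℂ] W := h ▸ LinearIsometryEquiv.refl ℂ V

/-- The indices which are not in the image of an injection. -/
@[ext]
structure Missing {m n : ℕ} (φ : Fin m ↪ Fin n) where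
  val : Fin n
  prop : ∀ j, φ j ≠ val

lemma Missing.val_injective {m n : ℕ} (φ : Fin m ↪ Fin n) :
    Function.Injective (Missing.val (φ := φ)) := fun _ _ => Missing.ext

instance {m n : ℕ} (φ : Fin m ↪ Fin n) : DecidableEq (Missing φ) :=
  (Missing.val_injective φ).decidableEq

instance {m n : ℕ} (φ : Fin m ↪ Fin n) : Fintype (Missing φ) :=
  have := Finite.of_injective _ (Missing.val_injective φ)
  Fintype.ofFinite _

section contract

variable {m n : ℕ} {V : Fin n → FdHilb} {W : Fin m → FdHilb} (φ : Fin m ↪ Fin n)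
  (h : ∀ j, V (φ j) = W j)

lemma contract_aux (i : Fin n) : (∃ j, φ j = i) ∨ ∀ j, φ j ≠ i := by
  by_cases h : ∃ j, φ j = i
  · exact Or.inl h
  · exact Or.inr fun j hj => h ⟨j, hj⟩

lemma prod_update [DecidableEq (Fin n)] (x : ∀ i : Missing φ, V i.val) (v : ∀ i, V i) (j : Fin m) (a : V (φ j)) :
    ∏ i : Missing φ, inner ℂ (x i) (Function.update v (φ j) a i.val) =
      ∏ i : Missing φ, inner ℂ (x i) (v i.val) :=
  Finset.prod_congr rfl fun i _ => by rw [Function.update_of_ne (i.prop j).symm]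

lemma prod_update' [DecidableEq (Fin n)] (x : ∀ i : Missing φ, V i.val) (v : ∀ i, V i) (i : Fin n) (hi : ∀ j, φ j ≠ i)
    (a : V i) : ∏ k : Missing φ, inner ℂ (x k) (Function.update v i a k.val) =
      inner ℂ (x ⟨i, hi⟩) a * ∏ k ∈ Finset.univ.erase (⟨i, hi⟩ : Missing φ),
        inner ℂ (x k) (v k.val) := by
  rw [← Finset.mul_prod_erase Finset.univ _ (Finset.mem_univ (⟨i, hi⟩ : Missing φ)),
    Function.update_self]
  congr 1
  refine Finset.prod_congr rfl fun k hk => ?_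
  rw [Function.update_of_ne]
  intro h
  exact (Finset.mem_erase.1 hk).1 (Missing.ext h)

lemma tprod_update [DecidableEq (Fin n)] (v : ∀ i, V i) (j : Fin m) (a : V (φ j)) :
    (tprod W fun k => castEquiv (h k) (Function.update v (φ j) a (φ k))) =
      tprod W (Function.update (fun k => castEquiv (h k) (v (φ k))) j (castEquiv (h j) a)) := by
  congr 1
  funext k
  by_cases hk : k = j
  · subst hk; rw [Function.update_self, Function.update_self]
  · rw [Function.update_of_ne hk, Function.update_of_ne (φ.injective.ne hk)]

lemma tprod_update' [DecidableEq (Fin n)] (v : ∀ i, V i) (i : Fin n) (hi : ∀ j, φ j ≠ i) (a : V i) :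
    (tprod W fun k => castEquiv (h k) (Function.update v i a (φ k))) =
      tprod W fun k => castEquiv (h k) (v (φ k)) := by
  congr 1
  funext k
  rw [Function.update_of_ne (hi k)]

/-- The linear map `V_1 ⊗ ⋯ ⊗ V_n → W_1 ⊗ ⋯ ⊗ W_m` with
`v_1 ⊗ ⋯ ⊗ v_n ↦ (∏_{i ∉ im φ} ⟨x_i, v_i⟩) v_{φ(1)} ⊗ ⋯ ⊗ v_{φ(m)}`, where `V_{φ(j)} = W_j`. -/
def contract (x : ∀ i : Missing φ, V i.val) : tens V →ₗ[ℂ] tens W :=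
  tlift V
    { toFun := fun v => (∏ i : Missing φ, inner ℂ (x i) (v i.val)) •
        tprod W fun j => castEquiv (h j) (v (φ j))
      map_update_add' := fun {inst} v i a b => by
        rcases contract_aux φ i with ⟨j, rfl⟩ | hi
        · simp only [prod_update φ x, tprod_update φ h, map_add, MultilinearMap.map_update_add,
            smul_add]
        · simp only [prod_update' φ x _ i hi, tprod_update' φ h _ i hi, inner_add_right, add_mul,
            add_smul]
      map_update_smul' := fun {inst} v i c a => by
        rcases contract_aux φ i with ⟨j, rfl⟩ | hi
        · simp only [prod_update φ x, tprod_update φ h, map_smul, MultilinearMap.map_update_smul]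
          rw [smul_comm]
        · simp only [prod_update' φ x _ i hi, tprod_update' φ h _ i hi, inner_smul_right, mul_assoc,
            mul_smul] }

lemma contract_tprod (x : ∀ i : Missing φ, V i.val) (v : ∀ i, V i) :
    contract φ h x (tprod V v) = (∏ i : Missing φ, inner ℂ (x i) (v i.val)) •
        tprod W fun j => castEquiv (h j) (v (φ j)) := tlift_tprod _ _ _

/-- The map `L(V_1 ⊗ ⋯ ⊗ V_n) → L(W_1 ⊗ ⋯ ⊗ W_m)` which takes the partial trace over the factors
`V_i` with `i ∉ im φ`, and identifies the factor `V_{φ(j)}` with `W_j`. Explicitly, the partial trace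
is `ρ ↦ ∑_z K_z ρ K_z†`, where the `z` are the families of elements of orthonormal bases of the
spaces `V_i` with `i ∉ im φ`, and `K_z` is the contraction against `z`. -/
def discard : L (tens V) →ₗ[ℂ] L (tens W) where
  toFun ρ := ∑ z : (∀ i : Missing φ, Fin (Module.finrank ℂ (V i.val))),
    contract φ h (fun i => stdOrthonormalBasis ℂ (V i.val) (z i)) ∘ₗ ρ ∘ₗ
      (contract φ h (fun i => stdOrthonormalBasis ℂ (V i.val) (z i))).adjoint
  map_add' ρ σ := by simp [LinearMap.add_comp, LinearMap.comp_add, Finset.sum_add_distrib]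
  map_smul' c ρ := by simp [LinearMap.smul_comp, LinearMap.comp_smul, Finset.smul_sum]

lemma isCP_discard : IsCP (discard φ h) := IsCP.of_fintype _ fun _ => rfl

lemma discard_ketbra (v w : ∀ i, V i) :
    discard φ h (ketbra (tprod V v) (tprod V w)) =
      (∏ i : Missing φ, inner ℂ (w i.val) (v i.val)) •
        ketbra (tprod W fun j => castEquiv (h j) (v (φ j)))
          (tprod W fun j => castEquiv (h j) (w (φ j))) := by
  have hs : ∀ (c d : ℂ) (a b : tens W), ketbra (c • a) (d • b) =
      (c * (starRingEnd ℂ) d) • ketbra a b := fun c d a b => by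
    ext x; simp [ketbra_apply, smul_smul]; congr 1; ring
  show ∑ z : (∀ i : Missing φ, Fin (Module.finrank ℂ (V i.val))), _ = _
  simp only [conj_ketbra, contract_tprod, hs, ← Finset.sum_smul, map_prod, inner_conj_symm,
    ← Finset.prod_mul_distrib]
  congr 1
  have : ∀ i : Missing φ, inner ℂ (w i.val) (v i.val) = ∑ k, inner ℂ (stdOrthonormalBasis ℂ (V i.val) k)
      (v i.val) * inner ℂ (w i.val) (stdOrthonormalBasis ℂ (V i.val) k) := fun i => by
    rw [← (stdOrthonormalBasis ℂ (V i.val)).sum_inner_mul_inner]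
    exact Finset.sum_congr rfl fun k _ => mul_comm _ _
  rw [Finset.prod_congr rfl fun i _ => this i, Finset.prod_univ_sum, Fintype.piFinset_univ]

lemma prod_missing (a : Fin n → ℂ) :
    ∏ i, a i = (∏ i : Missing φ, a i.val) * ∏ j, a (φ j) := by
  refine Eq.trans ?_ (Fintype.prod_sum_type
    (fun s : Missing φ ⊕ Fin m => a (Sum.elim (·.val) φ s)))
  symm
  refine Fintype.prod_bijective (Sum.elim (·.val) φ) ⟨?_, fun i => ?_⟩ _ _ fun _ => rfl
  · rintro (i | i) (j | j) hij
    · exact congrArg Sum.inl (Missing.ext hij)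
    · exact absurd hij.symm (i.prop j)
    · exact absurd hij (j.prop i)
    · exact congrArg Sum.inr (φ.injective hij)
  · rcases contract_aux φ i with ⟨j, rfl⟩ | hi
    · exact ⟨Sum.inr j, rfl⟩
    · exact ⟨Sum.inl ⟨i, hi⟩, rfl⟩

lemma prod_missing_trans {k : ℕ} (ψ : Fin k ↪ Fin m) (a : Fin n → ℂ) :
    ∏ i : Missing (ψ.trans φ), a i.1 =
      (∏ i : Missing φ, a i.val) * ∏ j : Missing ψ, a (φ j.val) := by
  refine Eq.trans ?_ (Fintype.prod_sum_type
    (fun s : Missing φ ⊕ Missing ψ => a (Sum.elim (·.val) (φ ·.val) s)))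
  symm
  let e : Missing φ ⊕ Missing ψ → Missing (ψ.trans φ) :=
    Sum.elim (fun i => ⟨i.val, fun j => i.prop _⟩) fun j => ⟨φ j.val, fun l hl => j.prop l (φ.injective hl)⟩
  refine Fintype.prod_bijective e ⟨?_, fun i => ?_⟩ _ _ ?_
  · rintro (i | i) (j | j) hij
    · exact congrArg Sum.inl (Missing.ext (congrArg (·.val) hij))
    · exact absurd (congrArg (·.val) hij).symm (i.prop j.val)
    · exact absurd (congrArg (·.val) hij) (j.prop i.val)
    · exact congrArg Sum.inr (Missing.ext (φ.injective (congrArg (·.val) hij)))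
  · rcases contract_aux φ i.val with ⟨j, hj⟩ | hi
    · exact ⟨Sum.inr ⟨j, fun l hl => i.prop l (by rw [← hj, ← hl]; rfl)⟩, Missing.ext hj⟩
    · exact ⟨Sum.inl ⟨i.val, hi⟩, rfl⟩
  · rintro (i | i) <;> rfl

lemma trace_discard (ρ : L (tens V)) : tr _ (discard φ h ρ) = tr _ ρ := by
  have : tr _ ∘ₗ discard φ h = tr _ := by
    apply ketbra_ext
    intro v w
    rw [LinearMap.comp_apply, discard_ketbra, map_smul, trace_ketbra, trace_ketbra, inner_tprod,
      inner_tprod, prod_missing φ, smul_eq_mul]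
    congr 1
    exact Finset.prod_congr rfl fun j _ => (castEquiv (h j)).inner_map_map _ _
  exact congrArg (fun T => T ρ) this

end contract

lemma castEquiv_refl {V : FdHilb} (h : V = V) (v : V) : castEquiv h v = v := rfl

lemma castEquiv_trans {U V W : FdHilb} (h : U = V) (h' : V = W) (v : U) :
    castEquiv h' (castEquiv h v) = castEquiv (h.trans h') v := by
  subst h; subst h'; rfl

lemma discard_refl {n : ℕ} (V : Fin n → FdHilb) (h : ∀ j, V (Function.Embedding.refl _ j) = V j) :
    discard (Function.Embedding.refl _) h = LinearMap.id := by
  apply ketbra_ext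
  intro v w
  rw [discard_ketbra, Finset.prod_eq_one fun i _ => absurd rfl (i.prop i.val), one_smul]
  rfl

lemma discard_comp {m n k : ℕ} {V : Fin n → FdHilb} {W : Fin m → FdHilb} {U : Fin k → FdHilb}
    (φ : Fin m ↪ Fin n) (h : ∀ j, V (φ j) = W j) (ψ : Fin k ↪ Fin m) (h' : ∀ j, W (ψ j) = U j)
    (h'' : ∀ j, V (ψ.trans φ j) = U j) :
    discard (ψ.trans φ) h'' = discard ψ h' ∘ₗ discard φ h := by
  apply ketbra_ext
  intro v w
  rw [LinearMap.comp_apply, discard_ketbra, discard_ketbra, map_smul, discard_ketbra, smul_smul]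
  simp only [castEquiv_trans, LinearIsometryEquiv.inner_map_map]
  congr 1
  exact prod_missing_trans φ ψ fun i => inner ℂ (w i) (v i)

/-- The strong monoidal functor `F̂` from the free affine monoidal category on the discrete category
of finite dimensional Hilbert spaces to `Q'ₛ`. It sends a sequence to the tensor product of its
terms, and a morphism with underlying injection `φ` to the map which discards the factors that are
not in the image of `φ`, and permutes the other ones according to `φ`. -/
def FHat : Fwm (Discrete FdHilb) ⥤ QsPrime where
  obj X := ⟨tens fun i => (X.obj i).as⟩
  map {X Y} f := show QsPrime.Hom ⟨tens fun i => (X.obj i).as⟩ ⟨tens fun i => (Y.obj i).as⟩ from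
    ⟨discard f.map fun j => Discrete.eq_of_hom (f.app j), isCP_discard _ _,
      fun ρ _ => trace_discard _ _ ρ⟩
  map_id _ := QsPrime.Hom.ext (discard_refl _ _)
  map_comp f g := QsPrime.Hom.ext
    (discard_comp f.map (fun j => Discrete.eq_of_hom (f.app j)) g.map
      (fun j => Discrete.eq_of_hom (g.app j)) _)

/-- The functor `Ψ : Q'' = (Fwm K)⁺ → Q`, the coproduct preserving extension of `F̂`. -/
def Psi : FinCoprod (Fwm (Discrete FdHilb)) ⥤ Q := extend FHat

end QModel

namespace QModel

open MonoidalCategory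

/-- A class of cones in a category, over diagrams of small shape. -/
abbrev ConeClass (E : Type*) [Category E] :=
  ∀ ⦃J : Type⦄ [SmallCategory J] (F : J ⥤ E), Set (Cone F)

/-- The class of all finite product cones, i.e. of all limit cones over finite discrete diagrams. -/
def finiteProductCones (E : Type*) [Category E] : ConeClass E :=
  fun J _ F => {c : Cone F | Finite J ∧ IsDiscrete J ∧ Nonempty (IsLimit c)}

/-- The tensor product distributes over finite coproducts. -/
def TensorDistributes (C : Type*) [Category C] [MonoidalCategory C] : Prop :=
  ∀ X : C, PreservesFiniteCoproducts (tensorLeft X) ∧ PreservesFiniteCoproducts (tensorRight X)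

/-- A class of cones in `Dᵒᵖ` is preserved by the opposite of the tensor functor (in each of its
variables). -/
def PreservedByOpTensor {D : Type*} [Category D] [MonoidalCategory D] (Γ : ConeClass Dᵒᵖ) : Prop :=
  ∀ (X : D) ⦃J : Type⦄ [SmallCategory J] (F : J ⥤ Dᵒᵖ), ∀ c ∈ Γ F,
    (tensorLeft X).op.mapCone c ∈ Γ (F ⋙ (tensorLeft X).op) ∧
      (tensorRight X).op.mapCone c ∈ Γ (F ⋙ (tensorRight X).op)

/-- There is an isomorphism `C(Φ b, c) × C(Φ b, c') ≅ C(Φ b, c ⊗ c')` which is natural in `b`, `c`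
and `c'`. -/
def MultiplicativeKernel {B C : Type*} [Category B] [Category C] [MonoidalCategory C]
    (Φ : B ⥤ C) : Prop :=
  ∃ e : ∀ (b : B) (c c' : C), (Φ.obj b ⟶ c) × (Φ.obj b ⟶ c') ≃ (Φ.obj b ⟶ c ⊗ c'),
    ∀ ⦃a b : B⦄ ⦃c d c' d' : C⦄ (β : a ⟶ b) (γ : c ⟶ d) (γ' : c' ⟶ d')
      (f : Φ.obj b ⟶ c) (g : Φ.obj b ⟶ c'),
      e a d d' (Φ.map β ≫ f ≫ γ, Φ.map β ≫ g ≫ γ') = Φ.map β ≫ e b c c' (f, g) ≫ (γ ⊗ₘ γ')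

/-- The hypotheses on `B ⥤ C ⥤ D` and on a class `Γ` of cones in `Dᵒᵖ` under which the presheaf
categories `[Bᵒᵖ, Set]`, `[Cᵒᵖ, Set]` and `[Dᵒᵖ, Set]_Γ` form an abstract model of the quantum lambda
calculus. Here `B` is regarded as a monoidal category through its finite products. -/
structure ModelHypotheses {B C D : Type*} [Category B] [CartesianMonoidalCategory B]
    [BraidedCategory B] [Category C] [MonoidalCategory C] [SymmetricCategory C] [Category D]
    [MonoidalCategory D] [SymmetricCategory D] (Φ : B ⥤ C) (Ψ : C ⥤ D) (Γ : ConeClass Dᵒᵖ) :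
    Prop where
  finiteProducts : HasFiniteProducts B
  coproducts_B : HasFiniteCoproducts B
  coproducts_C : HasFiniteCoproducts C
  coproducts_D : HasFiniteCoproducts D
  distributive_B : TensorDistributes B
  distributive_C : TensorDistributes C
  distributive_D : TensorDistributes D
  affine : Nonempty (IsTerminal (𝟙_ C))
  strongMonoidal_Φ : Nonempty Φ.Braided
  strongMonoidal_Ψ : Nonempty Ψ.Braided
  preservesCoproducts_Φ : PreservesFiniteCoproducts Φ
  preservesCoproducts_Ψ : PreservesFiniteCoproducts Ψ
  full : Φ.Full
  faithful : Φ.Faithful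
  essSurj : Ψ.EssSurj
  multiplicativeKernel : MultiplicativeKernel Φ
  preservedByOpTensor : PreservedByOpTensor Γ
  finiteProductCones_subset : ∀ ⦃J : Type⦄ [SmallCategory J] (F : J ⥤ Dᵒᵖ),
    finiteProductCones Dᵒᵖ F ⊆ Γ F

end QModel

end

/-! Coproducts in `C⁺` are disjoint unions of families, and its tensor product is componentwise over
the product of the index sets. Hence distributivity in `C⁺` is the bijection `A × ∐ B_j ≅ ∐ (A ×
B_j)`, and the unit of `C⁺` is terminal as soon as that of `C` is.

The properties of `Φ` come from the unit `I` of `Fwm K`. Since `I` is terminal, every component `I →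
I` is forced; this gives fullness, and all coherence equations for `Φ` hold automatically. Moreover
a morphism `I → X` exists only if the sequence `X` is empty, and is then unique. So a morphism from
`Φ A` to a family is determined by its function on indices, and pairs of such morphisms are the same
as morphisms into the tensor product (`Fwm.finSetHomProdEquiv`).

The analytic part is that `F̂` is strong monoidal as a functor to `Q`. The tensor product of a
concatenation splits by a unitary (`splitIso`). Operators on a tensor product are spanned by the
`|v_1 ⊗ ⋯ ⊗ v_n⟩⟨w_1 ⊗ ⋯ ⊗ w_n|`, and on these `F̂ f` multiplies by the inner products `⟨w_i, v_i⟩`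
of the discarded factors and reindexes the others (`FHatQ.lin_map_gen`). Every coherence equation
thereby becomes an identity between injections of finite sets.

The trace condition in `Q` is imposed on each column of a matrix separately, so a morphism out of `Ψ
X` is an arbitrary family of morphisms out of its terms. Hence `Ψ` preserves finite coproducts, and
its coherence equations can be tested on the terms, where `Psi.inj_delta` reduces them to those of
`F̂`. One-term sequences show that `Ψ` is essentially surjective.

The remaining statements are transferred: coproducts and distributivity pass to `Q` along the
essentially surjective `Ψ`, distributivity passes to finite sets along the fully faithful `Φ`, and
the condition on `Γ` is the dual form of distributivity in `Q`. -/

noncomputable section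

namespace QModel

open MonoidalCategory

/-! ### Transfer of coproducts, distributivity and monoidal structure along functors. -/

section General

universe v₁ v₂ v₃ u₁ u₂ u₃

variable {C : Type u₁} {D : Type u₂} {E : Type u₃} [Category.{v₁} C] [Category.{v₂} D]
  [Category.{v₃} E]

open Functor.OplaxMonoidal in
/-- An oplax monoidal functor whose structure morphisms are invertible and compatible with the
braidings is a braided strong monoidal functor. -/
theorem nonempty_braided_of_oplax [MonoidalCategory C] [MonoidalCategory D] [BraidedCategory C]
    [BraidedCategory D] (F : C ⥤ D) [F.OplaxMonoidal] [IsIso (η F)] [∀ X Y, IsIso (δ F X Y)]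
    (h : ∀ X Y, δ F X Y ≫ (β_ (F.obj X) (F.obj Y)).hom = F.map (β_ X Y).hom ≫ δ F Y X) :
    Nonempty F.Braided := by
  -- In this strong monoidal structure `μ` is by construction the inverse of `δ`, so the braiding
  -- axiom is `h` with both `δ` moved to the other side.
  let M : F.Monoidal := Functor.Monoidal.ofOplaxMonoidal F
  have hδ : ∀ X Y, Functor.LaxMonoidal.μ F X Y = inv (δ F X Y) := fun _ _ => rfl
  exact ⟨{ M with
    braided X Y := by
      rw [hδ, hδ, IsIso.inv_comp_eq, ← Category.assoc, IsIso.eq_comp_inv, h] }⟩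

/-- Colimit cocones over a diagram are isomorphic, so one convenient model of each coproduct
suffices; below it is always an explicit disjoint union. -/
theorem preservesFiniteCoproducts_of_exists_isColimit (F : C ⥤ D)
    (h : ∀ (n : ℕ) (K : Discrete (Fin n) ⥤ C),
      ∃ c : Cocone K, Nonempty (IsColimit c) ∧ Nonempty (IsColimit (F.mapCocone c))) :
    PreservesFiniteCoproducts F where
  preserves n := ⟨fun {K} => by
    obtain ⟨c, ⟨hc⟩, ⟨hFc⟩⟩ := h n K
    exact preservesColimit_of_preserves_colimit_cocone hc hFc⟩

/-- A diagram of discrete shape lifts, up to isomorphism, along an essentially surjective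
functor. -/
theorem exists_iso_discrete_comp {J : Type*} (P : C ⥤ D) [P.EssSurj] (K : Discrete J ⥤ D) :
    ∃ K' : Discrete J ⥤ C, Nonempty (K' ⋙ P ≅ K) :=
  ⟨Discrete.functor fun j => P.objPreimage (K.obj ⟨j⟩),
    ⟨Discrete.natIso fun j => P.objObjPreimageIso (K.obj j)⟩⟩

theorem hasFiniteCoproducts_of_essSurj (P : C ⥤ D) [P.EssSurj] [PreservesFiniteCoproducts P]
    [HasFiniteCoproducts C] : HasFiniteCoproducts D where
  out n := ⟨fun K => by
    obtain ⟨K', ⟨i⟩⟩ := exists_iso_discrete_comp P K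
    exact hasColimit_of_iso i.symm⟩

/-- Up to isomorphism every finite family in `D` comes from `C`, and its coproduct is then the image
under `P` of a coproduct. On that cocone `G` acts as `P ⋙ G` does. -/
theorem preservesFiniteCoproducts_of_essSurj_comp (P : C ⥤ D) [P.EssSurj]
    [PreservesFiniteCoproducts P] [HasFiniteCoproducts C] (G : D ⥤ E)
    [PreservesFiniteCoproducts (P ⋙ G)] : PreservesFiniteCoproducts G where
  preserves n := ⟨fun {K} => by
    obtain ⟨K', ⟨i⟩⟩ := exists_iso_discrete_comp P K
    have := preservesColimit_of_preserves_colimit_cocone (F := G)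
      (isColimitOfPreserves P (colimit.isColimit K'))
      (isColimitOfPreserves (P ⋙ G) (colimit.isColimit K'))
    exact preservesColimit_of_iso_diagram G i⟩

/-- Fully faithful functors reflect colimits. -/
theorem preservesFiniteCoproducts_of_comp_fullyFaithful (G : C ⥤ D) (P : D ⥤ E) [P.Full]
    [P.Faithful] [PreservesFiniteCoproducts (G ⋙ P)] : PreservesFiniteCoproducts G where
  preserves _ := preservesColimitsOfShape_of_reflects_of_preserves G P

theorem preservesFiniteCoproducts_of_iso {F G : C ⥤ D} (i : F ≅ G) [PreservesFiniteCoproducts F] :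
    PreservesFiniteCoproducts G where
  preserves _ := preservesColimitsOfShape_of_natIso i

/-- If `P` is a strong monoidal functor, then `P(X ⊗ -) ≅ P X ⊗ P -`. -/
def tensorLeftCompIso [MonoidalCategory C] [MonoidalCategory D] (P : C ⥤ D) [P.Monoidal] (X : C) :
    tensorLeft X ⋙ P ≅ P ⋙ tensorLeft (P.obj X) :=
  (Functor.Monoidal.commTensorLeft P X).symm

theorem preservesFiniteCoproducts_tensorRight [MonoidalCategory C] [BraidedCategory C] (X : C)
    [PreservesFiniteCoproducts (tensorLeft X)] : PreservesFiniteCoproducts (tensorRight X) :=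
  preservesFiniteCoproducts_of_iso (BraidedCategory.tensorLeftIsoTensorRight X)

theorem tensorDistributes_of_tensorLeft [MonoidalCategory C] [BraidedCategory C]
    (h : ∀ X : C, PreservesFiniteCoproducts (tensorLeft X)) : TensorDistributes C := fun X =>
  have := h X
  ⟨this, preservesFiniteCoproducts_tensorRight X⟩

/-- Since `P X ⊗ P - ≅ P (X ⊗ -)`, tensoring with `P X` preserves coproducts after precomposition
with `P`, hence outright; every object of `D` is isomorphic to some `P X`. Applied to `Ψ`. -/
theorem tensorDistributes_of_essSurj [MonoidalCategory C] [MonoidalCategory D] [BraidedCategory D]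
    (P : C ⥤ D) [P.Monoidal] [P.EssSurj] [PreservesFiniteCoproducts P] [HasFiniteCoproducts C]
    (h : TensorDistributes C) : TensorDistributes D :=
  tensorDistributes_of_tensorLeft fun X => by
    have := (h (P.objPreimage X)).1
    have := preservesFiniteCoproducts_of_iso (tensorLeftCompIso P (P.objPreimage X))
    have := preservesFiniteCoproducts_of_essSurj_comp P (tensorLeft (P.obj (P.objPreimage X)))
    exact preservesFiniteCoproducts_of_iso
      ((tensoringLeft D).mapIso (P.objObjPreimageIso X))

/-- The same isomorphism read in the other direction: `P (X ⊗ -)` preserves coproducts, and `P`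
reflects them. Applied to `Φ`. -/
theorem tensorDistributes_of_fullyFaithful [MonoidalCategory C] [MonoidalCategory D]
    [BraidedCategory C] (P : C ⥤ D) [P.Monoidal] [P.Full] [P.Faithful]
    [PreservesFiniteCoproducts P] (h : TensorDistributes D) : TensorDistributes C :=
  tensorDistributes_of_tensorLeft fun X => by
    have := (h (P.obj X)).1
    have := preservesFiniteCoproducts_of_iso (tensorLeftCompIso P X).symm
    exact preservesFiniteCoproducts_of_comp_fullyFaithful (tensorLeft X) P

/-- A functor which preserves finite products preserves limits over finite discrete categories. -/
theorem preservesLimitsOfShape_of_isDiscrete (F : C ⥤ D) [PreservesFiniteProducts F] (J : Type)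
    [SmallCategory J] [IsDiscrete J] [Finite J] : PreservesLimitsOfShape J F := by
  -- An abstractly discrete category is equivalent to `Discrete J`, the shape for which preservation
  -- of products is stated.
  have : (Discrete.functor (id : J → J)).IsEquivalence :=
    { faithful := ⟨fun _ => Subsingleton.elim _ _⟩
      full := ⟨fun {x y} f => ⟨eqToHom (Discrete.ext (IsDiscrete.eq_of_hom f)),
        Subsingleton.elim _ _⟩⟩
      essSurj := ⟨fun j => ⟨⟨j⟩, ⟨Iso.refl _⟩⟩⟩ }
  exact preservesLimitsOfShape_of_equiv (Discrete.functor (id : J → J)).asEquivalence F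

/-- Product cones in the opposite category are coproduct cocones, so this is distributivity
dualised. -/
theorem preservedByOpTensor_finiteProductCones [MonoidalCategory D] (h : TensorDistributes D) :
    PreservedByOpTensor (finiteProductCones Dᵒᵖ) := by
  rintro X J _ F c ⟨hJ, hJ', ⟨hc⟩⟩
  have := (h X).1
  have := (h X).2
  have := preservesFiniteProducts_op (tensorLeft X)
  have := preservesFiniteProducts_op (tensorRight X)
  have := preservesLimitsOfShape_of_isDiscrete (tensorLeft X).op J
  have := preservesLimitsOfShape_of_isDiscrete (tensorRight X).op J
  exact ⟨⟨hJ, hJ', ⟨isLimitOfPreserves _ hc⟩⟩, ⟨hJ, hJ', ⟨isLimitOfPreserves _ hc⟩⟩⟩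

end General

/-! ### Coproducts and distributivity in the completion `C⁺`. -/

section FinCoprod

universe v u

variable {C : Type u} [Category.{v} C]

namespace FinCoprod

/-- A cocone over a finite discrete diagram in `C⁺` which exhibits the family at its point as the
disjoint union of the given families, up to isomorphisms of the components. -/
structure IsDisjointUnion {J : Type} {K : Discrete J ⥤ FinCoprod C} (c : Cocone K) : Prop where
  bijective : Function.Bijective (α := Σ j, (K.obj ⟨j⟩).obj.I) (β := c.pt.obj.I)
    fun p => (c.ι.app ⟨p.1⟩).hom.f p.2
  isIso : ∀ (j : J) (i : (K.obj ⟨j⟩).obj.I), IsIso ((c.ι.app ⟨j⟩).hom.φ i)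

/-- The comparison isomorphism from the coproduct of the underlying families. -/
def IsDisjointUnion.iso {J : Type} {K : Discrete J ⥤ FinCoprod C} {c : Cocone K}
    (h : IsDisjointUnion c) :
    (FormalCoproduct.cofan J fun j => (K.obj ⟨j⟩).obj).pt ≅ c.pt.obj :=
  FormalCoproduct.isoOfComponents (Equiv.ofBijective _ h.bijective)
    fun p => @asIso _ _ _ _ ((c.ι.app ⟨p.1⟩).hom.φ p.2) (h.isIso p.1 p.2)

/-- Compatibility with the injections is what carries the universal property of the standard
coproduct over to `c`. -/
lemma IsDisjointUnion.inj_iso {J : Type} {K : Discrete J ⥤ FinCoprod C} {c : Cocone K}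
    (h : IsDisjointUnion c) (j : J) :
    (FormalCoproduct.cofan J fun j => (K.obj ⟨j⟩).obj).inj j ≫ h.iso.hom =
      (c.ι.app ⟨j⟩).hom :=
  congrArg (FormalCoproduct.Hom.mk _) (funext fun _ => Category.id_comp _)

/-- A disjoint union of families is their coproduct. -/
def IsDisjointUnion.isColimit {J : Type} {K : Discrete J ⥤ FinCoprod C} {c : Cocone K}
    (h : IsDisjointUnion c) : IsColimit c where
  desc s := ObjectProperty.homMk (h.iso.inv ≫ (FormalCoproduct.cofanHomEquiv J
    (fun j => (K.obj ⟨j⟩).obj) s.pt.obj).symm fun j => (s.ι.app ⟨j⟩).hom)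
  fac s := by
    rintro ⟨j⟩
    apply ObjectProperty.hom_ext
    refine (congrArg (· ≫ _) (h.inj_iso j).symm).trans ?_
    simp only [ObjectProperty.homMk_hom, Category.assoc, Iso.hom_inv_id_assoc]
    exact congrFun ((FormalCoproduct.cofanHomEquiv J (fun j => (K.obj ⟨j⟩).obj)
      s.pt.obj).apply_symm_apply fun j => (s.ι.app ⟨j⟩).hom) j
  uniq s m hm := by
    apply ObjectProperty.hom_ext
    rw [ObjectProperty.homMk_hom, Iso.eq_inv_comp, Equiv.eq_symm_apply]
    funext j
    change (FormalCoproduct.cofan J fun j => (K.obj ⟨j⟩).obj).inj j ≫ h.iso.hom ≫ m.hom = _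
    rw [← Category.assoc, h.inj_iso]
    exact congrArg (·.hom) (hm ⟨j⟩)

/-- The disjoint union of a finite family of objects of `C⁺`. -/
def sigmaCocone {J : Type} [Finite J] (K : Discrete J ⥤ FinCoprod C) : Cocone K where
  pt := ⟨⟨Σ j, (K.obj ⟨j⟩).obj.I, fun p => (K.obj ⟨p.1⟩).obj.obj p.2⟩,
    inferInstanceAs (Finite (Σ j, (K.obj ⟨j⟩).obj.I))⟩
  ι := Discrete.natTrans fun j => ObjectProperty.homMk ⟨fun i => ⟨j.as, i⟩, fun _ => 𝟙 _⟩

lemma isDisjointUnion_sigmaCocone {J : Type} [Finite J] (K : Discrete J ⥤ FinCoprod C) :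
    IsDisjointUnion (sigmaCocone K) where
  bijective := Function.bijective_id
  isIso _ _ := inferInstanceAs (IsIso (𝟙 _))

instance : HasFiniteCoproducts (FinCoprod C) where
  out _ := ⟨fun K => ⟨⟨⟨sigmaCocone K, (isDisjointUnion_sigmaCocone K).isColimit⟩⟩⟩⟩

/-- On indices, the pairs `(x, (j, i))` and the triples `(j, (x, i))` correspond; on components, the
injections are whiskered identities. Thus `X ⊗ -` sends a disjoint union to a disjoint union. -/
theorem tensorDistributes [MonoidalCategory C] [BraidedCategory C] :
    TensorDistributes (FinCoprod C) :=
  tensorDistributes_of_tensorLeft fun X =>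
    preservesFiniteCoproducts_of_exists_isColimit _ fun _ K =>
      ⟨sigmaCocone K, ⟨(isDisjointUnion_sigmaCocone K).isColimit⟩,
        ⟨IsDisjointUnion.isColimit
          { bijective := ⟨fun p q h => by
                obtain ⟨j, x, i⟩ := p
                obtain ⟨j', x', i'⟩ := q
                obtain ⟨hx, hi⟩ := Prod.ext_iff.1 h
                obtain rfl : x = x' := hx
                cases hi
                rfl,
              fun ⟨x, j, i⟩ => ⟨⟨j, x, i⟩, rfl⟩⟩
            isIso := fun j p => inferInstanceAs (IsIso (X.obj.obj p.1 ◁ 𝟙 _)) }⟩⟩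

/-- If the unit of `C` is terminal, then so is the unit of `C⁺`. -/
def isTerminalUnit [MonoidalCategory C] (h : IsTerminal (𝟙_ C)) : IsTerminal (𝟙_ (FinCoprod C)) :=
  IsTerminal.ofUniqueHom (fun _ => ObjectProperty.homMk ⟨fun _ => (), fun _ => h.from _⟩)
    fun _ _ => ObjectProperty.hom_ext _
      (FormalCoproduct.hom_ext rfl fun _ => h.hom_ext _ _)

end FinCoprod

/-! ### The functor `Φ` preserves coproducts and is full and faithful. -/

section FinSet

/-- The disjoint union of a finite family of finite sets. -/
def finSetSigmaCocone {J : Type} [Finite J] (K : Discrete J ⥤ FintypeCat.{0}) : Cocone K where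
  pt := FintypeCat.of (Σ j, K.obj ⟨j⟩)
  ι := Discrete.natTrans fun j => FintypeCat.homMk fun i => ⟨j.as, i⟩

/-- The disjoint union of finite sets is their coproduct. -/
def isColimitFinSetSigmaCocone {J : Type} [Finite J] (K : Discrete J ⥤ FintypeCat.{0}) :
    IsColimit (finSetSigmaCocone K) where
  desc s := FintypeCat.homMk fun p => s.ι.app ⟨p.1⟩ p.2
  fac s j := rfl
  uniq s m hm := FintypeCat.hom_ext _ _ fun p => by
    have := congrArg (fun f : K.obj ⟨p.1⟩ ⟶ s.pt => f p.2) (hm ⟨p.1⟩)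
    exact this

variable [MonoidalCategory C]

/-- A disjoint union of families that are constant at `I` is again constant at `I`. -/
instance : PreservesFiniteCoproducts (finSetFunctor C) :=
  preservesFiniteCoproducts_of_exists_isColimit _ fun _ K =>
    ⟨finSetSigmaCocone K, ⟨isColimitFinSetSigmaCocone K⟩,
      ⟨FinCoprod.IsDisjointUnion.isColimit
        { bijective := Function.bijective_id
          isIso := fun _ _ => inferInstanceAs (IsIso (𝟙 _)) }⟩⟩

instance : (finSetFunctor C).Faithful where
  map_injective {A B} _ _ h := FintypeCat.hom_ext _ _ fun a =>
    congrFun (congrArg (fun f : (finSetFunctor C).obj A ⟶ (finSetFunctor C).obj B => f.hom.f) h) a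

/-- The components of a morphism between constant families are endomorphisms of the terminal object
`I`, hence identities; only the function on indices remains. -/
theorem full_finSetFunctor (h : IsTerminal (𝟙_ C)) : (finSetFunctor C).Full where
  map_surjective f := ⟨FintypeCat.homMk f.hom.f, ObjectProperty.hom_ext _
    (FormalCoproduct.hom_ext rfl fun _ => h.hom_ext _ _)⟩

end FinSet

end FinCoprod

/-! ### The functor `Φ` is strong symmetric monoidal. -/

section FinSetMonoidal

universe v u

variable {C : Type u} [Category.{v} C] [MonoidalCategory C]

/-- If the unit `I` of `C` is terminal, then so is `I ⊗ I`. -/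
def isTerminalUnitTensorUnit (h : IsTerminal (𝟙_ C)) : IsTerminal (𝟙_ C ⊗ 𝟙_ C) :=
  h.ofIso (λ_ (𝟙_ C)).symm

/-- The functor `FinSet → C⁺` is oplax monoidal. -/
abbrev oplaxMonoidalFinSetFunctor (h : IsTerminal (𝟙_ C)) : (finSetFunctor C).OplaxMonoidal where
  η := ObjectProperty.homMk ⟨fun _ => (), fun _ => 𝟙 _⟩
  δ _ _ := ObjectProperty.homMk ⟨fun p => p, fun _ => (λ_ _).inv⟩
  δ_natural_left _ _ := ObjectProperty.hom_ext _
    (FormalCoproduct.hom_ext rfl fun _ => (isTerminalUnitTensorUnit h).hom_ext _ _)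
  δ_natural_right _ _ := ObjectProperty.hom_ext _
    (FormalCoproduct.hom_ext rfl fun _ => (isTerminalUnitTensorUnit h).hom_ext _ _)
  oplax_associativity _ _ _ := ObjectProperty.hom_ext _
    (FormalCoproduct.hom_ext rfl fun _ =>
      ((isTerminalUnitTensorUnit h).ofIso (whiskerLeftIso _ (λ_ (𝟙_ C)).symm)).hom_ext _ _)
  oplax_left_unitality _ := ObjectProperty.hom_ext _
    (FormalCoproduct.hom_ext rfl fun _ => (isTerminalUnitTensorUnit h).hom_ext _ _)
  oplax_right_unitality _ := ObjectProperty.hom_ext _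
    (FormalCoproduct.hom_ext rfl fun _ => (isTerminalUnitTensorUnit h).hom_ext _ _)

/-- An isomorphism of families, given by isomorphisms of the components. -/
def FinCoprod.isoMk {X Y : FinCoprod C} (e : X.obj.I ≃ Y.obj.I)
    (i : ∀ a, X.obj.obj a ≅ Y.obj.obj (e a)) : X ≅ Y :=
  (finiteFamily C).isoMk (FormalCoproduct.isoOfComponents e i)

/-- The structure morphisms are bijections on indices with invertible components. The braiding
square commutes on indices by computation and on components because `I ⊗ I` is terminal. -/
theorem nonempty_braided_finSetFunctor [BraidedCategory C] (h : IsTerminal (𝟙_ C)) :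
    Nonempty (finSetFunctor C).Braided := by
  let _ := oplaxMonoidalFinSetFunctor h
  have : IsIso (Functor.OplaxMonoidal.η (finSetFunctor C)) :=
    inferInstanceAs (IsIso (FinCoprod.isoMk (X := (finSetFunctor C).obj (𝟙_ _))
      (Y := 𝟙_ (FinCoprod C)) (Equiv.refl Unit) fun _ => Iso.refl _).hom)
  have : ∀ A B, IsIso (Functor.OplaxMonoidal.δ (finSetFunctor C) A B) := fun A B =>
    inferInstanceAs (IsIso (FinCoprod.isoMk (X := (finSetFunctor C).obj (A ⊗ B))
      (Y := (finSetFunctor C).obj A ⊗ (finSetFunctor C).obj B) (Equiv.refl (A.obj × B.obj))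
      fun _ => (λ_ (𝟙_ C)).symm).hom)
  exact nonempty_braided_of_oplax _ fun A B => ObjectProperty.hom_ext _
    (FormalCoproduct.hom_ext rfl fun _ => (isTerminalUnitTensorUnit h).hom_ext _ _)

end FinSetMonoidal

/-! ### Morphisms out of the unit of `Fwm K`, and the multiplicative kernel. -/

namespace Fwm

variable {α : Type*}

/-- The unit of the free affine monoidal category is terminal. -/
def isTerminalUnit : IsTerminal (𝟙_ (Fwm (Discrete α))) :=
  IsTerminal.ofUniqueHom (fun _ => homMk ⟨Fin.elim0, fun i => i.elim0⟩ fun i => i.elim0)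
    fun _ _ => hom_ext fun i => i.elim0

/-- A morphism out of the unit has empty codomain. -/
lemma isEmpty_of_unit_hom {X : Fwm (Discrete α)} (f : 𝟙_ (Fwm (Discrete α)) ⟶ X) :
    IsEmpty (Fin X.len) := ⟨fun i => (f.map i : Fin 0).elim0⟩

lemma unit_hom_ext {X : Fwm (Discrete α)} (f g : 𝟙_ (Fwm (Discrete α)) ⟶ X) : f = g :=
  have := isEmpty_of_unit_hom f
  hom_ext fun i => this.elim i

/-- The first projection of a tensor product in the free affine monoidal category. -/
def fst (X Y : Fwm (Discrete α)) : X ⊗ Y ⟶ X := X ◁ isTerminalUnit.from Y ≫ (ρ_ X).hom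

/-- The second projection of a tensor product in the free affine monoidal category. -/
def snd (X Y : Fwm (Discrete α)) : X ⊗ Y ⟶ Y := isTerminalUnit.from X ▷ Y ≫ (λ_ Y).hom

/-- Components starting at the unit are unique, so equations between such morphisms only need to be
checked on indices. -/
lemma finSetFunctor_hom_ext {A : FintypeCat.{0}} {X : FinCoprod (Fwm (Discrete α))}
    {f g : (finSetFunctor _).obj A ⟶ X} (h : ∀ a : A, f.hom.f a = g.hom.f a) : f = g :=
  ObjectProperty.hom_ext _ (FormalCoproduct.hom_ext (funext h) fun _ => unit_hom_ext _ _)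

/-- Morphisms from a finite set to a tensor product are pairs of morphisms. -/
def finSetHomProdEquiv (A : FintypeCat.{0}) (X Y : FinCoprod (Fwm (Discrete α))) :
    ((finSetFunctor _).obj A ⟶ X) × ((finSetFunctor _).obj A ⟶ Y) ≃
      ((finSetFunctor _).obj A ⟶ X ⊗ Y) where
  toFun p := ObjectProperty.homMk ⟨fun a => (p.1.hom.f a, p.2.hom.f a),
    fun a => (λ_ _).inv ≫ (p.1.hom.φ a ⊗ₘ p.2.hom.φ a)⟩
  invFun f :=
    (ObjectProperty.homMk ⟨fun a => (f.hom.f a).1, fun a => f.hom.φ a ≫ fst _ _⟩,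
      ObjectProperty.homMk ⟨fun a => (f.hom.f a).2, fun a => f.hom.φ a ≫ snd _ _⟩)
  -- The components need no computation with `fst` and `snd`: on indices both round trips are
  -- pairing and projecting.
  left_inv _ := Prod.ext (finSetFunctor_hom_ext fun _ => rfl) (finSetFunctor_hom_ext fun _ => rfl)
  right_inv _ := finSetFunctor_hom_ext fun _ => rfl

theorem multiplicativeKernel_finSetFunctor :
    MultiplicativeKernel (finSetFunctor (Fwm (Discrete α))) :=
  ⟨finSetHomProdEquiv, fun _ _ _ _ _ _ _ _ _ _ _ => finSetFunctor_hom_ext fun _ => rfl⟩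

end Fwm

open scoped TensorProduct
open FdHilb MonoidalCategory

/-! ### The unitary that splits the tensor product of a concatenated sequence. -/

section split

variable {m n : ℕ} {U : Fin (m + n) → FdHilb} {V : Fin m → FdHilb} {W : Fin n → FdHilb}
  (hV : ∀ i, U (Fin.castAddEmb n i) = V i) (hW : ∀ i, U (Fin.natAddEmb m i) = W i)

/-- The components of a family along an injection of index sets. -/
def pull {m n : ℕ} {V : Fin n → FdHilb} {W : Fin m → FdHilb} (φ : Fin m ↪ Fin n)
    (h : ∀ j, V (φ j) = W j) (v : ∀ i, V i) (j : Fin m) : W j :=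
  castEquiv (h j) (v (φ j))

/-- The type of `v i` depends on `i`, so an index is replaced by an equal one only together with its
cast. -/
lemma castEquiv_congr {n : ℕ} {V : Fin n → FdHilb} {W : FdHilb} (v : ∀ i, V i) {i j : Fin n}
    (hij : i = j) (h : V i = W) (h' : V j = W) : castEquiv h (v i) = castEquiv h' (v j) := by
  subst hij; rfl

lemma pull_pull {m n k : ℕ} {V : Fin n → FdHilb} {W : Fin m → FdHilb} {U : Fin k → FdHilb}
    (φ : Fin m ↪ Fin n) (h : ∀ j, V (φ j) = W j) (ψ : Fin k ↪ Fin m) (h' : ∀ j, W (ψ j) = U j)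
    (v : ∀ i, V i) :
    pull ψ h' (pull φ h v) = pull (ψ.trans φ) (fun j => (h _).trans (h' j)) v :=
  funext fun _ => castEquiv_trans _ _ _

/-- With `pull_pull`, this reduces each coherence law for `F̂` to a comparison of injections, the
casts of Hilbert spaces being absorbed. -/
lemma pull_congr {m n : ℕ} {V : Fin n → FdHilb} {W : Fin m → FdHilb} {φ ψ : Fin m ↪ Fin n}
    (h : ∀ j, V (φ j) = W j) (h' : ∀ j, V (ψ j) = W j) (hφ : ∀ j, φ j = ψ j) (v : ∀ i, V i) :
    pull φ h v = pull ψ h' v :=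
  funext fun j => castEquiv_congr v (hφ j) _ _

lemma natAdd_ne_castAdd (i : Fin n) (j : Fin m) : Fin.natAddEmb m i ≠ Fin.castAddEmb n j := by
  intro h
  have := congrArg Fin.val h
  simp at this
  omega

lemma tprod_pull_update {m n : ℕ} {V : Fin n → FdHilb} {W : Fin m → FdHilb} (φ : Fin m ↪ Fin n)
    (h : ∀ j, V (φ j) = W j) [DecidableEq (Fin n)] (v : ∀ i, V i) (j : Fin m) (a : V (φ j)) :
    tprod W (pull φ h (Function.update v (φ j) a)) =
      tprod W (Function.update (pull φ h v) j (castEquiv (h j) a)) :=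
  tprod_update φ h v j a

lemma tprod_pull_update_of_ne {m n : ℕ} {V : Fin n → FdHilb} {W : Fin m → FdHilb}
    (φ : Fin m ↪ Fin n) (h : ∀ j, V (φ j) = W j) [DecidableEq (Fin n)] (v : ∀ i, V i) {i : Fin n}
    (hi : ∀ j, φ j ≠ i) (a : V i) :
    tprod W (pull φ h (Function.update v i a)) = tprod W (pull φ h v) :=
  tprod_update' φ h v i hi a

lemma exists_castAddEmb_or_natAddEmb (i : Fin (m + n)) :
    (∃ j, Fin.castAddEmb n j = i) ∨ ∃ j, Fin.natAddEmb m j = i :=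
  Fin.addCases (fun j => Or.inl ⟨j, rfl⟩) (fun j => Or.inr ⟨j, rfl⟩) i

/-- The multilinear map `(u_1, …, u_{m + n}) ↦ (u_1 ⊗ ⋯ ⊗ u_m) ⊗ (u_{m + 1} ⊗ ⋯ ⊗ u_{m + n})`. -/
def tprodSplit : MultilinearMap ℂ (fun i => (U i : Type)) (tensor (tens V) (tens W)) where
  toFun v := tprod V (pull _ hV v) ⊗ₜ tprod W (pull _ hW v)
  map_update_add' := fun {inst} v i a b => by
    -- The updated index lies in one block only: that elementary tensor is updated in the same way,
    -- and the other one does not change.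
    rcases exists_castAddEmb_or_natAddEmb i with ⟨i, rfl⟩ | ⟨i, rfl⟩
    · simp only [tprod_pull_update, tprod_pull_update_of_ne _ hW v fun j => natAdd_ne_castAdd j i]
      rw [map_add, MultilinearMap.map_update_add]
      exact TensorProduct.add_tmul _ _ _
    · simp only [tprod_pull_update,
        tprod_pull_update_of_ne _ hV v fun j => (natAdd_ne_castAdd i j).symm]
      rw [map_add, MultilinearMap.map_update_add]
      exact TensorProduct.tmul_add _ _ _
  map_update_smul' := fun {inst} v i c a => by
    rcases exists_castAddEmb_or_natAddEmb i with ⟨i, rfl⟩ | ⟨i, rfl⟩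
    · simp only [tprod_pull_update, tprod_pull_update_of_ne _ hW v fun j => natAdd_ne_castAdd j i]
      rw [map_smul, MultilinearMap.map_update_smul]
      exact TensorProduct.smul_tmul' _ _ _
    · simp only [tprod_pull_update,
        tprod_pull_update_of_ne _ hV v fun j => (natAdd_ne_castAdd i j).symm]
      rw [map_smul, MultilinearMap.map_update_smul]
      exact TensorProduct.tmul_smul _ _ _

/-- The canonical map `U_1 ⊗ ⋯ ⊗ U_{m + n} → (U_1 ⊗ ⋯ ⊗ U_m) ⊗ (U_{m + 1} ⊗ ⋯ ⊗ U_{m + n})`. -/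
def splitLin : tens U →ₗ[ℂ] tensor (tens V) (tens W) := tlift U (tprodSplit hV hW)

lemma splitLin_tprod (v : ∀ i, U i) :
    splitLin hV hW (tprod U v) = tprod V (pull _ hV v) ⊗ₜ tprod W (pull _ hW v) :=
  tlift_tprod _ _ _

/-- Both sides are sesquilinear and the elementary tensors span. -/
lemma inner_eq_of_tprod {n : ℕ} {V : Fin n → FdHilb} {H : FdHilb} (S : tens V →ₗ[ℂ] H)
    (h : ∀ v w, inner ℂ (S (tprod V v)) (S (tprod V w)) = inner ℂ (tprod V v) (tprod V w))
    (a b : tens V) : inner ℂ (S a) (S b) = inner ℂ a b := by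
  have ha : a ∈ Submodule.span ℂ (Set.range (tprod V)) := by rw [span_tprod]; trivial
  have hb : b ∈ Submodule.span ℂ (Set.range (tprod V)) := by rw [span_tprod]; trivial
  induction ha using Submodule.span_induction with
  | mem a ha =>
    obtain ⟨v, rfl⟩ := ha
    induction hb using Submodule.span_induction with
    | mem b hb => obtain ⟨w, rfl⟩ := hb; exact h v w
    | zero => simp
    | add x y _ _ hx hy => simp [hx, hy]
    | smul c x _ hx => simp [hx]
  | zero => simp
  | add x y _ _ hx hy => simp [hx, hy]
  | smul c x _ hx => simp [hx]

/-- For elementary tensors both sides are products of inner products, and a product over `Fin (m +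
n)` factors over the two blocks; the casts are isometries. -/
lemma splitLin_inner (a b : tens U) :
    inner ℂ (splitLin hV hW a) (splitLin hV hW b) = inner ℂ a b := by
  refine inner_eq_of_tprod _ (fun v w => ?_) a b
  rw [splitLin_tprod, splitLin_tprod]
  refine (TensorProduct.inner_tmul (𝕜 := ℂ) (E := tens V) (F := tens W) _ _ _ _).trans ?_
  rw [inner_tprod, inner_tprod, inner_tprod, Fin.prod_univ_add]
  simp only [pull, LinearIsometryEquiv.inner_map_map]
  rfl

lemma exists_pull_eq (v : ∀ i, V i) (w : ∀ i, W i) :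
    ∃ u : ∀ i, U i, pull _ hV u = v ∧ pull _ hW u = w := by
  refine ⟨Fin.addCases (motive := fun i => U i) (fun i => castEquiv (hV i).symm (v i))
    (fun i => castEquiv (hW i).symm (w i)), funext fun i => ?_, funext fun i => ?_⟩
  · exact (congrArg (castEquiv (hV i)) (Fin.addCases_left i)).trans (castEquiv_trans _ _ _)
  · exact (congrArg (castEquiv (hW i)) (Fin.addCases_right i)).trans (castEquiv_trans _ _ _)

/-- The range is a subspace. It contains the products of two elementary tensors, as two families can
be concatenated (`exists_pull_eq`), and these span. -/
lemma splitLin_surjective : Function.Surjective (splitLin hV hW) := by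
  rw [← LinearMap.range_eq_top, eq_top_iff]
  have key : ∀ (a : tens V) (b : tens W), a ⊗ₜ b ∈ LinearMap.range (splitLin hV hW) := by
    intro a b
    have ha : a ∈ Submodule.span ℂ (Set.range (tprod V)) := by rw [span_tprod]; trivial
    have hb : b ∈ Submodule.span ℂ (Set.range (tprod W)) := by rw [span_tprod]; trivial
    induction ha using Submodule.span_induction with
    | mem a ha =>
      obtain ⟨v, rfl⟩ := ha
      induction hb using Submodule.span_induction with
      | mem b hb =>
        obtain ⟨w, rfl⟩ := hb
        obtain ⟨u, rfl, rfl⟩ := exists_pull_eq hV hW v w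
        exact ⟨_, splitLin_tprod hV hW u⟩
      | zero => rw [TensorProduct.tmul_zero]; exact Submodule.zero_mem _
      | add x y _ _ hx hy => rw [TensorProduct.tmul_add]; exact Submodule.add_mem _ hx hy
      | smul c x _ hx => rw [TensorProduct.tmul_smul]; exact Submodule.smul_mem _ _ hx
    | zero => rw [TensorProduct.zero_tmul]; exact Submodule.zero_mem _
    | add x y _ _ hx hy => rw [TensorProduct.add_tmul]; exact Submodule.add_mem _ hx hy
    | smul c x _ hx => rw [← TensorProduct.smul_tmul']; exact Submodule.smul_mem _ _ hx
  intro x _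
  induction x using TensorProduct.induction_on with
  | zero => exact Submodule.zero_mem _
  | add x y hx hy => exact Submodule.add_mem _ (hx trivial) (hy trivial)
  | tmul a b => exact key a b

/-- The unitary `U_1 ⊗ ⋯ ⊗ U_{m + n} ≅ (U_1 ⊗ ⋯ ⊗ U_m) ⊗ (U_{m + 1} ⊗ ⋯ ⊗ U_{m + n})`. -/
def splitIso : tens U ≃ₗᵢ[ℂ] tensor (tens V) (tens W) :=
  LinearIsometryEquiv.ofSurjective ((splitLin hV hW).isometryOfInner (splitLin_inner hV hW))
    (splitLin_surjective hV hW)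

lemma splitIso_tprod (v : ∀ i, U i) :
    splitIso hV hW (tprod U v) = tprod V (pull _ hV v) ⊗ₜ tprod W (pull _ hW v) :=
  splitLin_tprod hV hW v

lemma conjU_ketbra {V W : FdHilb} (u : V ≃ₗᵢ[ℂ] W) (a b : V) :
    conjU u (ketbra a b) = ketbra (u a) (u b) := by
  ext x
  -- Unitarity turns `⟨b, u⁻¹ x⟩` into `⟨u b, x⟩`.
  simp [conjU_apply, ketbra_apply, ← u.inner_map_map b]

lemma conjU_splitIso_ketbra (v w : ∀ i, U i) :
    conjU (splitIso hV hW) (ketbra (tprod U v) (tprod U w)) =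
      opTensor (ketbra (tprod V (pull _ hV v)) (tprod V (pull _ hV w)))
        (ketbra (tprod W (pull _ hW v)) (tprod W (pull _ hW w))) := by
  rw [conjU_ketbra, splitIso_tprod, splitIso_tprod, opTensor_ketbra]

end split

/-! ### Products over the indices missed by an injection. -/

section missing

/-- An index is missed by the disjoint union of `f` and `g` exactly when it is missed by the
injection acting on its block. Thus the scalar of a partial trace factors over a tensor product. -/
lemma prod_missing_sumMap {m n m' n' : ℕ} (f : Fin m ↪ Fin n) (g : Fin m' ↪ Fin n')
    (a : Fin (n + n') → ℂ) :
    ∏ i : Missing (Fwm.sumMap f g), a i.val =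
      (∏ i : Missing f, a (Fin.castAddEmb n' i.val)) *
        ∏ i : Missing g, a (Fin.natAddEmb n i.val) := by
  refine Eq.trans ?_ (Fintype.prod_sum_type (fun s : Missing f ⊕ Missing g =>
    a (Sum.elim (fun i => Fin.castAddEmb n' i.val) (fun i => Fin.natAddEmb n i.val) s)))
  symm
  let e : Missing f ⊕ Missing g → Missing (Fwm.sumMap f g) :=
    Sum.elim
      (fun i => ⟨Fin.castAddEmb n' i.val, fun j => by
        refine Fin.addCases (fun j => ?_) (fun j => ?_) j
        · rw [Fwm.sumMap_castAdd]
          exact fun h => i.prop j ((Fin.castAddEmb n').injective h)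
        · rw [Fwm.sumMap_natAdd]
          exact natAdd_ne_castAdd _ _⟩)
      (fun i => ⟨Fin.natAddEmb n i.val, fun j => by
        refine Fin.addCases (fun j => ?_) (fun j => ?_) j
        · rw [Fwm.sumMap_castAdd]
          exact (natAdd_ne_castAdd _ _).symm
        · rw [Fwm.sumMap_natAdd]
          exact fun h => i.prop j ((Fin.natAddEmb n).injective h)⟩)
  refine Fintype.prod_bijective e ⟨?_, fun i => ?_⟩ _ _ ?_
  · rintro (i | i) (j | j) hij
    · exact congrArg Sum.inl (Missing.ext ((Fin.castAddEmb n').injective (congrArg (·.val) hij)))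
    · exact absurd (congrArg (·.val) hij).symm (natAdd_ne_castAdd _ _)
    · exact absurd (congrArg (·.val) hij) (natAdd_ne_castAdd _ _)
    · exact congrArg Sum.inr (Missing.ext ((Fin.natAddEmb n).injective (congrArg (·.val) hij)))
  · obtain ⟨i, hi⟩ := i
    induction i using Fin.addCases with
    | left i =>
      refine ⟨Sum.inl ⟨i, fun j hj => hi (Fin.castAdd m' j) ?_⟩, rfl⟩
      rw [Fwm.sumMap_castAdd, hj]
    | right i =>
      refine ⟨Sum.inr ⟨i, fun j hj => hi (Fin.natAdd m j) ?_⟩, rfl⟩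
      rw [Fwm.sumMap_natAdd, hj]
  · rintro (i | i) <;> rfl

lemma prod_missing_of_surjective {m n : ℕ} {f : Fin m ↪ Fin n} (hf : Function.Surjective f)
    (a : Missing f → ℂ) : ∏ i, a i = 1 :=
  Finset.prod_eq_one fun i _ => by
    obtain ⟨j, hj⟩ := hf i.val
    exact absurd hj (i.prop j)

end missing

/-! ### The structure morphisms of `Q` on elementary tensors. -/

namespace Q

variable {X X' Y Y' Z : Q}

/-- The elements `(a_i ⊗ b_j)_{(i, j)}` of the space of a tensor product. -/
def tmul (a : Alg X) (b : Alg Y) : Alg (X ⊗ Y) := box a b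

lemma smul_tmul (c : ℂ) (a : Alg X) (b : Alg Y) : tmul (c • a) b = c • tmul a b :=
  congrFun (congrArg DFunLike.coe ((boxB X Y).map_smul c a)) b

lemma tmul_smul (c : ℂ) (a : Alg X) (b : Alg Y) : tmul a (c • b) = c • tmul a b :=
  (boxB X Y a).map_smul c b

lemma lin_tensorHom_tmul (f : X ⟶ X') (g : Y ⟶ Y') (a : Alg X) (b : Alg Y) :
    lin (f ⊗ₘ g) (tmul a b) = tmul (lin f a) (lin g b) := lin_tensorHom f g a b

lemma lin_whiskerRight_tmul (f : X ⟶ X') (a : Alg X) (b : Alg Y) :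
    lin (f ▷ Y) (tmul a b) = tmul (lin f a) b :=
  (lin_tensorHom f (𝟙 Y) a b).trans (by rw [lin_id]; rfl)

lemma lin_whiskerLeft_tmul (f : Y ⟶ Y') (a : Alg X) (b : Alg Y) :
    lin (X ◁ f) (tmul a b) = tmul a (lin f b) :=
  (lin_tensorHom (𝟙 X) f a b).trans (by rw [lin_id]; rfl)

lemma lin_associator_tmul (a : Alg X) (b : Alg Y) (c : Alg Z) :
    lin (α_ X Y Z).hom (tmul (tmul a b) c) = tmul a (tmul b c) := lin_assocHom a b c

/-- An operator on `ℂ` is multiplication by its value at `1`, which is the scalar that appears here.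
-/
lemma lin_leftUnitor_tmul (s : Alg (𝟙_ Q)) (a : Alg X) :
    lin (λ_ X).hom (tmul s a) = (show ℂ from s () (1 : ℂ)) • a := lin_leftHom s a

lemma lin_rightUnitor_tmul (s : Alg (𝟙_ Q)) (a : Alg X) :
    lin (ρ_ X).hom (tmul a s) = (show ℂ from s () (1 : ℂ)) • a := lin_rightHom s a

lemma lin_braiding_tmul (a : Alg X) (b : Alg Y) :
    lin (β_ X Y).hom (tmul a b) = tmul b a := lin_braidHom a b

/-- The isomorphism given by a bijection of index sets and unitaries. -/
def reindexIso (e : Y.idx ≃ X.idx) (u : ∀ i, X.sp (e i) ≃ₗᵢ[ℂ] Y.sp i) : X ≅ Y where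
  hom := reindex e e.injective u
  -- The inverse of `u (e.symm i)` lands in the space at `e (e.symm i)`, which equals the one at `i`
  -- only propositionally; hence the cast.
  inv := reindex e.symm e.symm.injective fun i =>
    (u (e.symm i)).symm.trans (castEquiv (congrArg X.sp (e.apply_symm_apply i)))
  hom_inv_id := hom_ext fun a => funext fun i => by
    -- Replacing `e.symm i` by a variable `j` with `e j = i` allows the equality, and with it the
    -- cast, to be eliminated.
    have : ∀ (j : Y.idx) (h : e j = i),
        conjU ((u j).symm.trans (castEquiv (congrArg X.sp h))) (conjU (u j) (a (e j))) = a i := by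
      rintro j rfl
      exact conjU_symm _ _
    rw [lin_comp, lin_id, lin_reindex, lin_reindex]
    exact this _ (e.apply_symm_apply _)
  inv_hom_id := hom_ext fun a => funext fun i => by
    have : ∀ (j : Y.idx) (h : e j = e i),
        conjU (u i) (conjU ((u j).symm.trans (castEquiv (congrArg X.sp h))) (a j)) = a i := by
      intro j h
      obtain rfl := e.injective h
      exact conjU_symm' _ _
    rw [lin_comp, lin_id, lin_reindex, lin_reindex]
    exact this _ (e.apply_symm_apply _)

lemma lin_reindexIso_hom (e : Y.idx ≃ X.idx) (u : ∀ i, X.sp (e i) ≃ₗᵢ[ℂ] Y.sp i) (a : Alg X)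
    (i : Y.idx) : lin (reindexIso e u).hom a i = conjU (u i) (a (e i)) :=
  lin_reindex _ e.injective _ _ _

end Q

/-! ### The functor `F̂`, viewed in `Q`, is strong symmetric monoidal. -/

/-- The composite of `F̂` with the inclusion in `Q`. -/
abbrev FHatQ : Fwm (Discrete FdHilb) ⥤ Q := FHat ⋙ QsPrime.toQ

namespace FHatQ

/-- The Hilbert spaces of a sequence. -/
abbrev sp (X : Fwm (Discrete FdHilb)) (i : Fin X.len) : FdHilb := (X.obj i).as

variable {X Y Z : Fwm (Discrete FdHilb)}

/-- The operator `|v_1 ⊗ ⋯ ⊗ v_n⟩⟨w_1 ⊗ ⋯ ⊗ w_n|`. -/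
def gen (v w : ∀ i, sp X i) : Q.Alg (FHatQ.obj X) :=
  fun _ => ketbra (tprod (sp X) v) (tprod (sp X) w)

/-- The operators `gen v w` span, since elementary tensors span and every operator is a sum of rank
one operators. -/
lemma hom_ext {T : Q} {f g : FHatQ.obj X ⟶ T}
    (h : ∀ v w : ∀ i, sp X i, Q.lin f (gen v w) = Q.lin g (gen v w)) : f = g := by
  -- `P` identifies operators with one-term families of operators, so that `ketbra_ext` applies.
  let P : L (tens (sp X)) →ₗ[ℂ] Q.Alg (FHatQ.obj X) := LinearMap.pi fun _ => LinearMap.id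
  have : Q.lin f ∘ₗ P = Q.lin g ∘ₗ P := ketbra_ext (V := sp X) h
  exact Q.hom_ext fun a => congrArg (fun S => S (a ())) this

lemma eq_of_hom (f : X ⟶ Y) (j : Fin Y.len) : sp X (f.map j) = sp Y j :=
  Discrete.eq_of_hom (f.app j)

/-- The trace of `|v_i⟩⟨w_i|` is `⟨w_i, v_i⟩`: each discarded factor contributes a scalar and the
others are permuted. The coherence laws below are computed with this formula. -/
lemma lin_map_gen (f : X ⟶ Y) (v w : ∀ i, sp X i) :
    Q.lin (FHatQ.map f) (gen v w) = (∏ i : Missing f.map, inner ℂ (w i.val) (v i.val)) •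
      gen (pull f.map (eq_of_hom f) v) (pull f.map (eq_of_hom f) w) := by
  funext i
  refine (Q.Hom.toLin_apply _ _ _).trans ((Fintype.sum_unique (ι := Unit) _).trans ?_)
  exact discard_ketbra f.map (eq_of_hom f) v w

lemma lin_map_gen_of_surjective (f : X ⟶ Y) (hf : Function.Surjective f.map)
    (v w : ∀ i, sp X i) : Q.lin (FHatQ.map f) (gen v w) =
      gen (pull f.map (eq_of_hom f) v) (pull f.map (eq_of_hom f) w) := by
  rw [lin_map_gen, prod_missing_of_surjective hf, one_smul]

lemma sp_castAdd (X Y : Fwm (Discrete FdHilb)) (i : Fin X.len) :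
    sp (X ⊗ Y) (Fin.castAddEmb Y.len i) = sp X i :=
  congrArg Discrete.as (Fin.append_left X.obj Y.obj i)

lemma sp_natAdd (X Y : Fwm (Discrete FdHilb)) (i : Fin Y.len) :
    sp (X ⊗ Y) (Fin.natAddEmb X.len i) = sp Y i :=
  congrArg Discrete.as (Fin.append_right X.obj Y.obj i)

/-- The components in the first factor of a concatenation. -/
def left (v : ∀ i, sp (X ⊗ Y) i) : ∀ i, sp X i :=
  pull (V := sp (X ⊗ Y)) (Fin.castAddEmb Y.len) (sp_castAdd X Y) v

/-- The components in the second factor of a concatenation. -/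
def right (v : ∀ i, sp (X ⊗ Y) i) : ∀ i, sp Y i :=
  pull (V := sp (X ⊗ Y)) (Fin.natAddEmb X.len) (sp_natAdd X Y) v

/-- The unitary `F̂ (X ⊗ Y) ≅ F̂ X ⊗ F̂ Y`. -/
def splitU (X Y : Fwm (Discrete FdHilb)) :
    tens (sp (X ⊗ Y)) ≃ₗᵢ[ℂ] tensor (tens (sp X)) (tens (sp Y)) :=
  splitIso (U := sp (X ⊗ Y)) (sp_castAdd X Y) (sp_natAdd X Y)

lemma conjU_splitU_ketbra (v w : ∀ i, sp (X ⊗ Y) i) :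
    conjU (splitU X Y) (ketbra (tprod (sp (X ⊗ Y)) v) (tprod (sp (X ⊗ Y)) w)) =
      opTensor (ketbra (tprod (sp X) (left v)) (tprod (sp X) (left w)))
        (ketbra (tprod (sp Y) (right v)) (tprod (sp Y) (right w))) :=
  conjU_splitIso_ketbra (U := sp (X ⊗ Y)) (sp_castAdd X Y) (sp_natAdd X Y) v w

/-- The isomorphism `F̂ (X ⊗ Y) ≅ F̂ X ⊗ F̂ Y` in `Q`. -/
def deltaIso (X Y : Fwm (Discrete FdHilb)) :
    FHatQ.obj (X ⊗ Y) ≅ FHatQ.obj X ⊗ FHatQ.obj Y :=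
  Q.reindexIso (X := FHatQ.obj (X ⊗ Y)) (Y := Q.tensorObj (FHatQ.obj X) (FHatQ.obj Y))
    ⟨fun _ => (), fun _ => ((), ()), fun _ => rfl, fun _ => rfl⟩ fun _ => splitU X Y

lemma lin_deltaIso_gen (v w : ∀ i, sp (X ⊗ Y) i) :
    Q.lin (deltaIso X Y).hom (gen v w) =
      Q.tmul (gen (left v) (left w)) (gen (right v) (right w)) := by
  funext i
  exact (Q.lin_reindexIso_hom _ _ _ _).trans (conjU_splitU_ketbra v w)

/-- The isomorphism of `F̂ I` with the unit of `Q`. -/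
def etaIso : FHatQ.obj (𝟙_ (Fwm (Discrete FdHilb))) ≅ 𝟙_ Q := Iso.refl (𝟙_ Q)

/-- The empty elementary tensor is `1 : ℂ`, and `|1⟩⟨1|` is the identity of `ℂ`; so the unit laws
carry the scalar `1`. -/
lemma lin_etaIso_gen (v w : ∀ i, sp (𝟙_ (Fwm (Discrete FdHilb))) i) :
    (show ℂ from Q.lin etaIso.hom (gen v w) () (1 : ℂ)) = 1 := by
  have h : Q.lin etaIso.hom (gen v w) = gen v w := Q.lin_id (𝟙_ Q) _
  rw [h]
  change (inner ℂ (1 : ℂ) (1 : ℂ)) • (1 : ℂ) = 1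
  simp

lemma left_pull_whiskerRight (f : X ⟶ Y) (v : ∀ i, sp (X ⊗ Z) i) :
    left (pull (f ▷ Z).map (eq_of_hom (f ▷ Z)) v) = pull f.map (eq_of_hom f) (left v) := by
  unfold left
  rw [pull_pull, pull_pull]
  exact pull_congr _ _ (fun j => Fwm.sumMap_castAdd _ _ _) v

lemma right_pull_whiskerRight (f : X ⟶ Y) (v : ∀ i, sp (X ⊗ Z) i) :
    right (pull (f ▷ Z).map (eq_of_hom (f ▷ Z)) v) = right v := by
  unfold right
  rw [pull_pull]
  exact pull_congr _ _ (fun j => Fwm.sumMap_natAdd _ _ _) v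

lemma left_pull_whiskerLeft (f : X ⟶ Y) (v : ∀ i, sp (Z ⊗ X) i) :
    left (pull (Z ◁ f).map (eq_of_hom (Z ◁ f)) v) = left v := by
  unfold left
  rw [pull_pull]
  exact pull_congr _ _ (fun j => Fwm.sumMap_castAdd _ _ _) v

lemma right_pull_whiskerLeft (f : X ⟶ Y) (v : ∀ i, sp (Z ⊗ X) i) :
    right (pull (Z ◁ f).map (eq_of_hom (Z ◁ f)) v) = pull f.map (eq_of_hom f) (right v) := by
  unfold right
  rw [pull_pull, pull_pull]
  exact pull_congr _ _ (fun j => Fwm.sumMap_natAdd _ _ _) v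

/-- The identity of `Z` discards nothing, so only the factors missed by `f` contribute; the casts in
`left` preserve inner products. -/
lemma prod_missing_whiskerRight (f : X ⟶ Y) (v w : ∀ i, sp (X ⊗ Z) i) :
    ∏ i : Missing (f ▷ Z).map, inner ℂ (w i.val) (v i.val) =
      ∏ i : Missing f.map, inner ℂ (left w i.val) (left v i.val) := by
  refine (prod_missing_sumMap f.map (𝟙 Z : Z ⟶ Z).map fun i => inner ℂ (w i) (v i)).trans ?_
  rw [prod_missing_of_surjective (f := (𝟙 Z : Z ⟶ Z).map) Function.surjective_id, mul_one]
  exact Finset.prod_congr rfl fun i _ => ((castEquiv _).inner_map_map _ _).symm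

lemma prod_missing_whiskerLeft (f : X ⟶ Y) (v w : ∀ i, sp (Z ⊗ X) i) :
    ∏ i : Missing (Z ◁ f).map, inner ℂ (w i.val) (v i.val) =
      ∏ i : Missing f.map, inner ℂ (right w i.val) (right v i.val) := by
  refine (prod_missing_sumMap (𝟙 Z : Z ⟶ Z).map f.map fun i => inner ℂ (w i) (v i)).trans ?_
  rw [prod_missing_of_surjective (f := (𝟙 Z : Z ⟶ Z).map) Function.surjective_id, one_mul]
  exact Finset.prod_congr rfl fun i _ => ((castEquiv _).inner_map_map _ _).symm

lemma surjective_map_of_isIso (f : X ⟶ Y) [IsIso f] : Function.Surjective f.map := fun i =>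
  ⟨(inv f).map i, congrArg (fun g : X ⟶ X => g.map i) (IsIso.hom_inv_id f)⟩

/-- `F̂` is oplax monoidal. -/
instance : FHatQ.OplaxMonoidal where
  η := etaIso.hom
  δ X Y := (deltaIso X Y).hom
  δ_natural_left f Z := hom_ext fun v w => by
    rw [Q.lin_comp, Q.lin_comp, lin_deltaIso_gen, Q.lin_whiskerRight_tmul, lin_map_gen,
      lin_map_gen, map_smul, lin_deltaIso_gen, Q.smul_tmul, left_pull_whiskerRight,
      left_pull_whiskerRight, right_pull_whiskerRight, right_pull_whiskerRight,
      prod_missing_whiskerRight]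
  δ_natural_right Z f := hom_ext fun v w => by
    rw [Q.lin_comp, Q.lin_comp, lin_deltaIso_gen, Q.lin_whiskerLeft_tmul, lin_map_gen,
      lin_map_gen, map_smul, lin_deltaIso_gen, Q.tmul_smul, left_pull_whiskerLeft,
      left_pull_whiskerLeft, right_pull_whiskerLeft, right_pull_whiskerLeft,
      prod_missing_whiskerLeft]
  oplax_associativity X Y Z := hom_ext fun v w => by
    simp only [Q.lin_comp]
    rw [lin_deltaIso_gen, Q.lin_whiskerRight_tmul, lin_deltaIso_gen, Q.lin_associator_tmul,
      lin_map_gen_of_surjective _ (surjective_map_of_isIso _), lin_deltaIso_gen,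
      Q.lin_whiskerLeft_tmul, lin_deltaIso_gen]
    -- For each of the three blocks, restriction before and after rebracketing is a pull along the
    -- same injection. Only the third block needs associativity of addition.
    have h1 : ∀ u : ∀ i, sp ((X ⊗ Y) ⊗ Z) i,
        left (pull (α_ X Y Z).hom.map (eq_of_hom (α_ X Y Z).hom) u) = left (left u) := fun u => by
      unfold left
      rw [pull_pull, pull_pull]
      exact pull_congr _ _ (fun j => rfl) u
    have h2 : ∀ u : ∀ i, sp ((X ⊗ Y) ⊗ Z) i,
        left (right (pull (α_ X Y Z).hom.map (eq_of_hom (α_ X Y Z).hom) u)) = right (left u) :=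
      fun u => (congrArg left (pull_pull _ _ _ _ u)).trans ((pull_pull _ _ _ _ u).trans
        ((pull_congr _ _ (fun j => rfl) u).trans
          (show right (left u) = _ from pull_pull _ _ _ _ u).symm))
    have h3 : ∀ u : ∀ i, sp ((X ⊗ Y) ⊗ Z) i,
        right (right (pull (α_ X Y Z).hom.map (eq_of_hom (α_ X Y Z).hom) u)) = right u :=
      fun u => (congrArg right (pull_pull _ _ _ _ u)).trans ((pull_pull _ _ _ _ u).trans
        (pull_congr _ _ (fun j => Fin.ext (Nat.add_assoc _ _ _).symm) u))
    simp only [h1, h2, h3]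
  oplax_left_unitality X := by
    -- The inverse unitor of `Q` has no formula on elementary tensors here, so it is cancelled
    -- against the unitor.
    rw [← cancel_mono (λ_ _).hom, Iso.inv_hom_id]
    refine hom_ext fun v w => ?_
    simp only [Q.lin_comp]
    rw [lin_map_gen_of_surjective _ (surjective_map_of_isIso _), lin_deltaIso_gen,
      Q.lin_whiskerRight_tmul]
    refine (Q.lin_id _ _).trans (Eq.symm ?_)
    refine (Q.lin_leftUnitor_tmul _ _).trans ?_
    have h : ∀ u : ∀ i, sp X i,
        right (pull (λ_ X).inv.map (eq_of_hom (λ_ X).inv) u) = u := fun u => by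
      unfold right
      rw [pull_pull]
      exact pull_congr (φ := _) (ψ := Function.Embedding.refl _) _ (fun _ => rfl)
        (fun j => Fin.ext (Nat.zero_add _)) u
    rw [lin_etaIso_gen, h, h, one_smul]
  oplax_right_unitality X := by
    rw [← cancel_mono (ρ_ _).hom, Iso.inv_hom_id]
    refine hom_ext fun v w => ?_
    simp only [Q.lin_comp]
    rw [lin_map_gen_of_surjective _ (surjective_map_of_isIso _), lin_deltaIso_gen,
      Q.lin_whiskerLeft_tmul]
    refine (Q.lin_id _ _).trans (Eq.symm ?_)
    refine (Q.lin_rightUnitor_tmul _ _).trans ?_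
    have h : ∀ u : ∀ i, sp X i,
        left (pull (ρ_ X).inv.map (eq_of_hom (ρ_ X).inv) u) = u := fun u => by
      unfold left
      rw [pull_pull]
      exact pull_congr (φ := _) (ψ := Function.Embedding.refl _) _ (fun _ => rfl)
        (fun j => rfl) u
    rw [lin_etaIso_gen, h, h, one_smul]

instance : IsIso (Functor.OplaxMonoidal.η FHatQ) := inferInstanceAs (IsIso etaIso.hom)

instance (X Y : Fwm (Discrete FdHilb)) : IsIso (Functor.OplaxMonoidal.δ FHatQ X Y) :=
  inferInstanceAs (IsIso (deltaIso X Y).hom)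

/-- `finAddFlip` exchanges the two blocks, so on generators both composites exchange the left and
right parts. -/
lemma delta_braiding (X Y : Fwm (Discrete FdHilb)) :
    Functor.OplaxMonoidal.δ FHatQ X Y ≫ (β_ (FHatQ.obj X) (FHatQ.obj Y)).hom =
      FHatQ.map (β_ X Y).hom ≫ Functor.OplaxMonoidal.δ FHatQ Y X := by
  change (deltaIso X Y).hom ≫ _ = _ ≫ (deltaIso Y X).hom
  refine hom_ext fun v w => ?_
  rw [Q.lin_comp, Q.lin_comp, lin_deltaIso_gen, Q.lin_braiding_tmul,
    lin_map_gen_of_surjective _ (surjective_map_of_isIso _), lin_deltaIso_gen]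
  have h1 : ∀ u : ∀ i, sp (X ⊗ Y) i,
      left (pull (β_ X Y).hom.map (eq_of_hom (β_ X Y).hom) u) = right u := fun u => by
    unfold left right
    rw [pull_pull]
    exact pull_congr _ _ (fun j => finAddFlip_apply_castAdd _ _) u
  have h2 : ∀ u : ∀ i, sp (X ⊗ Y) i,
      right (pull (β_ X Y).hom.map (eq_of_hom (β_ X Y).hom) u) = left u := fun u => by
    unfold left right
    rw [pull_pull]
    exact pull_congr _ _ (fun j => finAddFlip_apply_natAdd _ _) u
  simp only [h1, h2]

theorem nonempty_braided : Nonempty FHatQ.Braided :=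
  nonempty_braided_of_oplax FHatQ delta_braiding

end FHatQ

lemma opTensor_zero {V W : FdHilb} (A : L V) : opTensor A (0 : L W) = 0 :=
  (opTensorB V W A).map_zero

lemma zero_opTensor {V W : FdHilb} (B : L W) : opTensor (0 : L V) B = 0 :=
  (opTensorB V W).map_zero₂ B

/-! ### The functor induced on `C⁺` preserves finite coproducts. -/

namespace extend

universe v u

variable {C : Type u} [Category.{v} C] (G : C ⥤ QsPrime) {X Y : FinCoprod C} {T : Q}

/-- The injection of a term of a family. -/
def inj (X : FinCoprod C) (a : X.obj.I) : (G ⋙ QsPrime.toQ).obj (X.obj.obj a) ⟶ (extend G).obj X :=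
  show Q.Hom ((G ⋙ QsPrime.toQ).obj (X.obj.obj a)) (extendObj G X) from
  { entry := fun i _ => Q.delta (extendObj G X) i a
    cp := fun i _ => Q.isCP_delta _ _
    trace_le := fun _ ρ _ => by
      rw [Finset.sum_eq_single a]
      · rw [Q.delta_self]; rfl
      · intro b _ hb
        rw [Q.delta_ne hb]
        exact congrArg Complex.re (map_zero (tr _))
      · simp }

/-- The morphism out of a family which is given by morphisms out of its terms. -/
def desc (g : ∀ a : X.obj.I, (G ⋙ QsPrime.toQ).obj (X.obj.obj a) ⟶ T) : (extend G).obj X ⟶ T :=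
  show Q.Hom (extendObj G X) T from
  { entry := fun i a => Q.Hom.entry (g a) i ()
    cp := fun i a => Q.Hom.cp (g a) i ()
    trace_le := fun a => Q.Hom.trace_le (g a) () }

variable {G}

/-- Precomposition with an injection selects a column of the matrix, because the injection is a
column of the identity matrix. -/
lemma entry_inj_comp (a : X.obj.I) (f : (extend G).obj X ⟶ T) (i : T.idx) (j : Unit) :
    Q.Hom.entry (inj G X a ≫ f) i j = Q.Hom.entry f i a := by
  refine (Finset.sum_eq_single (M := L _ →ₗ[ℂ] L _) a ?_ ?_).trans ?_
  · intro b _ hb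
    have : Q.delta (extendObj G X) b a = 0 := Q.delta_ne hb
    exact (congrArg (fun S => Q.Hom.entry f i b ∘ₗ S) this).trans (LinearMap.comp_zero _)
  · exact fun h => absurd (@Finset.mem_univ _ (extendObj G X).fin a) h
  · have : Q.delta (extendObj G X) a a = LinearMap.id := Q.delta_self _
    exact (congrArg (fun S => Q.Hom.entry f i a ∘ₗ S) this).trans (LinearMap.comp_id _)

lemma hom_ext {f g : (extend G).obj X ⟶ T} (h : ∀ a, inj G X a ≫ f = inj G X a ≫ g) : f = g :=
  Q.Hom.ext (funext fun i => funext fun a => by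
    have := congrArg (fun k => Q.Hom.entry k i ()) (h a)
    exact (entry_inj_comp a f i ()).symm.trans (this.trans (entry_inj_comp a g i ())))

lemma inj_desc (g : ∀ a : X.obj.I, (G ⋙ QsPrime.toQ).obj (X.obj.obj a) ⟶ T) (a : X.obj.I) :
    inj G X a ≫ desc G g = g a :=
  Q.Hom.ext (funext fun i => funext fun j => entry_inj_comp a (desc G g) i j)

lemma inj_map (f : X ⟶ Y) (a : X.obj.I) :
    inj G X a ≫ (extend G).map f =
      (G ⋙ QsPrime.toQ).map (f.hom.φ a) ≫ inj G Y (f.hom.f a) :=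
  Q.Hom.ext (funext fun i => funext fun j => by
    have h : Q.Hom.entry ((G ⋙ QsPrime.toQ).map (f.hom.φ a) ≫ inj G Y (f.hom.f a)) i j =
        ∑ k : Unit, Q.Hom.entry (inj G Y (f.hom.f a)) i k ∘ₗ
          Q.Hom.entry ((G ⋙ QsPrime.toQ).map (f.hom.φ a)) k j := rfl
    refine (entry_inj_comp a _ i j).trans (Eq.trans ?_ h.symm)
    rw [Fintype.sum_unique]
    rfl)

/-- The value at a family is the coproduct in `Q` of the values at its terms: `hom_ext` and
`inj_desc` are its universal property. For a disjoint union, the terms may be grouped by summand. -/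
instance : PreservesFiniteCoproducts (extend G) :=
  preservesFiniteCoproducts_of_exists_isColimit _ fun n K => by
    have h : ∀ (j : Fin n) (a : (K.obj ⟨j⟩).obj.I),
        inj G (K.obj ⟨j⟩) a ≫ ((extend G).mapCocone (FinCoprod.sigmaCocone K)).ι.app ⟨j⟩ =
          inj G (FinCoprod.sigmaCocone K).pt ⟨j, a⟩ := fun j a => by
      refine (inj_map ((FinCoprod.sigmaCocone K).ι.app ⟨j⟩) a).trans ?_
      refine (congrArg (· ≫ inj G (FinCoprod.sigmaCocone K).pt ⟨j, a⟩)
        ((G ⋙ QsPrime.toQ).map_id _)).trans (Category.id_comp _)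
    exact ⟨FinCoprod.sigmaCocone K, ⟨(FinCoprod.isDisjointUnion_sigmaCocone K).isColimit⟩,
      ⟨{ desc := fun s => desc G fun p => inj G (K.obj ⟨p.1⟩) p.2 ≫ s.ι.app ⟨p.1⟩
         fac := fun s j => hom_ext fun a => by
            rw [← Category.assoc]
            exact (congrArg (· ≫ _) (h j.as a)).trans (inj_desc _ _)
         uniq := fun s m hm => hom_ext fun p => by
            refine Eq.trans ?_ (inj_desc _ _).symm
            refine (congrArg (· ≫ m) (h p.1 p.2).symm).trans ((Category.assoc _ _ _).trans ?_)
            exact congrArg (inj G _ p.2 ≫ ·) (hm ⟨p.1⟩) }⟩⟩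

end extend

/-! ### The functor `Ψ` is strong symmetric monoidal and essentially surjective. -/

namespace Psi

open Functor.OplaxMonoidal extend

variable {X Y Z : FinCoprod (Fwm (Discrete FdHilb))}

/-- The isomorphism `Ψ (X ⊗ Y) ≅ Ψ X ⊗ Ψ Y`. -/
def deltaIso (X Y : FinCoprod (Fwm (Discrete FdHilb))) :
    Psi.obj (X ⊗ Y) ≅ Psi.obj X ⊗ Psi.obj Y :=
  Q.reindexIso (X := Psi.obj (X ⊗ Y)) (Y := Q.tensorObj (Psi.obj X) (Psi.obj Y))
    (Equiv.refl (X.obj.I × Y.obj.I)) fun p => FHatQ.splitU (X.obj.obj p.1) (Y.obj.obj p.2)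

/-- The injection of a term of a family. -/
abbrev inj (X : FinCoprod (Fwm (Discrete FdHilb))) (a : X.obj.I) :
    FHatQ.obj (X.obj.obj a) ⟶ Psi.obj X := extend.inj FHat X a

lemma lin_inj (a : X.obj.I) (x : Q.Alg (FHatQ.obj (X.obj.obj a))) :
    Q.lin (inj X a) x = fun i => Q.delta (Psi.obj X) i a (x ()) :=
  funext fun _ => (Q.Hom.toLin_apply _ _ _).trans (Fintype.sum_unique (ι := Unit) _)

/-- An identity matrix on pairs of indices is the tensor product of two identity matrices: both
sides vanish unless `i = a` and `j = b`, and then the claim is `h`. -/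
lemma conjU_delta (i a : X.obj.I) (j b : Y.obj.I)
    (A : L (FHat.obj (X.obj.obj a)).sp) (B : L (FHat.obj (Y.obj.obj b)).sp)
    (ρ : L (FHat.obj (X.obj.obj a ⊗ Y.obj.obj b)).sp)
    (h : conjU (FHatQ.splitU (X.obj.obj a) (Y.obj.obj b)) ρ = opTensor A B) :
    conjU (FHatQ.splitU (X.obj.obj i) (Y.obj.obj j)) (Q.delta (Psi.obj (X ⊗ Y)) (i, j) (a, b) ρ) =
      opTensor (Q.delta (Psi.obj X) i a A) (Q.delta (Psi.obj Y) j b B) := by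
  -- The space in which an entry acts depends on its index, so the indices are identified before
  -- `delta_self` can be used.
  by_cases hi : i = a
  · subst hi
    by_cases hj : j = b
    · subst hj
      have h1 : Q.delta (Psi.obj (X ⊗ Y)) (i, j) (i, j) ρ = ρ :=
        LinearMap.congr_fun (Q.delta_self (X := Psi.obj (X ⊗ Y)) (i, j)) ρ
      have h2 : Q.delta (Psi.obj X) i i A = A :=
        LinearMap.congr_fun (Q.delta_self (X := Psi.obj X) i) A
      have h3 : Q.delta (Psi.obj Y) j j B = B :=
        LinearMap.congr_fun (Q.delta_self (X := Psi.obj Y) j) B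
      exact (congrArg (conjU _) h1).trans (h.trans (congrArg₂ opTensor h2 h3).symm)
    · have h1 : Q.delta (Psi.obj (X ⊗ Y)) (i, j) (i, b) ρ = 0 :=
        LinearMap.congr_fun (Q.delta_ne (X := Psi.obj (X ⊗ Y)) (i := (i, j)) (j := (i, b)) fun h =>
          hj (congrArg (Prod.snd (α := X.obj.I) (β := Y.obj.I)) h)) ρ
      have h3 : Q.delta (Psi.obj Y) j b B = 0 :=
        LinearMap.congr_fun (Q.delta_ne (X := Psi.obj Y) hj) B
      exact (congrArg (conjU _) h1).trans ((LinearMap.map_zero _).trans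
        ((congrArg (opTensor _) h3).trans (opTensor_zero _)).symm)
  · have h1 : Q.delta (Psi.obj (X ⊗ Y)) (i, j) (a, b) ρ = 0 :=
      LinearMap.congr_fun (Q.delta_ne (X := Psi.obj (X ⊗ Y)) (i := (i, j)) (j := (a, b)) fun h =>
        hi (congrArg (Prod.fst (α := X.obj.I) (β := Y.obj.I)) h)) ρ
    have h2 : Q.delta (Psi.obj X) i a A = 0 :=
      LinearMap.congr_fun (Q.delta_ne (X := Psi.obj X) hi) A
    exact (congrArg (conjU _) h1).trans ((LinearMap.map_zero _).trans
      ((congrArg (opTensor · _) h2).trans (zero_opTensor _)).symm)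

/-- The bridge between the two monoidal structures: on each pair of terms, the comparison for `Ψ` is
that for `F̂`. -/
lemma inj_delta (a : X.obj.I) (b : Y.obj.I) :
    inj (X ⊗ Y) (a, b) ≫ (deltaIso X Y).hom =
      δ FHatQ (X.obj.obj a) (Y.obj.obj b) ≫ (inj X a ⊗ₘ inj Y b) := by
  refine FHatQ.hom_ext fun v w => ?_
  have h : Q.lin (δ FHatQ (X.obj.obj a) (Y.obj.obj b)) (FHatQ.gen v w) =
      Q.tmul (FHatQ.gen (FHatQ.left v) (FHatQ.left w))
        (FHatQ.gen (FHatQ.right v) (FHatQ.right w)) := FHatQ.lin_deltaIso_gen v w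
  rw [Q.lin_comp, Q.lin_comp, h, Q.lin_tensorHom_tmul, lin_inj, lin_inj, lin_inj]
  funext p
  exact (Q.lin_reindexIso_hom _ _ _ _).trans (conjU_delta p.1 a p.2 b _ _ _
    (FHatQ.conjU_splitU_ketbra (X := X.obj.obj a) (Y := Y.obj.obj b) v w))

/-- The isomorphism of `Ψ I` with the unit of `Q`. -/
def etaIso : Psi.obj (𝟙_ _) ≅ 𝟙_ Q :=
  Q.reindexIso (X := Psi.obj (𝟙_ _)) (Y := Q.tensorUnit) (Equiv.refl Unit)
    fun _ => LinearIsometryEquiv.refl ℂ _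

lemma inj_eta : inj (𝟙_ _) () ≫ etaIso.hom = η FHatQ := by
  refine Q.hom_ext fun x => funext fun i => ?_
  rw [Q.lin_comp, lin_inj]
  refine (Q.lin_reindexIso_hom _ _ _ _).trans ?_
  have h : Q.lin (η FHatQ) x = x := Q.lin_id (𝟙_ Q) _
  rw [h]
  refine (congrArg (conjU (LinearIsometryEquiv.refl ℂ _))
    (LinearMap.congr_fun (Q.delta_self (X := Psi.obj (𝟙_ _)) ()) (x ()))).trans ?_
  ext
  rfl

/-- Left unitality of `F̂`, in the form that arises when unitality of `Ψ` is tested on a term, with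
`g` the injection of that term. -/
lemma map_leftUnitor_inv_delta (A : Fwm (Discrete FdHilb)) {T : Q} (g : FHatQ.obj A ⟶ T) :
    FHatQ.map (λ_ A).inv ≫ δ FHatQ (𝟙_ _) A ≫ (η FHatQ ⊗ₘ g) ≫ (λ_ T).hom = g := by
  rw [MonoidalCategory.tensorHom_def, Category.assoc, leftUnitor_naturality, ← left_unitality_assoc,
    Iso.inv_hom_id_assoc]

lemma map_rightUnitor_inv_delta (A : Fwm (Discrete FdHilb)) {T : Q} (g : FHatQ.obj A ⟶ T) :
    FHatQ.map (ρ_ A).inv ≫ δ FHatQ A (𝟙_ _) ≫ (g ⊗ₘ η FHatQ) ≫ (ρ_ T).hom = g := by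
  rw [tensorHom_def', Category.assoc, rightUnitor_naturality, ← right_unitality_assoc,
    Iso.inv_hom_id_assoc]

lemma inj_delta_assoc (a : X.obj.I) (b : Y.obj.I) {T : Q} (f : Psi.obj X ⊗ Psi.obj Y ⟶ T) :
    inj (X ⊗ Y) (a, b) ≫ (deltaIso X Y).hom ≫ f =
      δ FHatQ (X.obj.obj a) (Y.obj.obj b) ≫ (inj X a ⊗ₘ inj Y b) ≫ f := by
  rw [← Category.assoc, inj_delta, Category.assoc]

lemma inj_map (f : X ⟶ Y) (a : X.obj.I) :
    inj X a ≫ Psi.map f = FHatQ.map (f.hom.φ a) ≫ inj Y (f.hom.f a) := extend.inj_map f a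

lemma inj_map_assoc (f : X ⟶ Y) (a : X.obj.I) {T : Q} (g : Psi.obj Y ⟶ T) :
    inj X a ≫ Psi.map f ≫ g = FHatQ.map (f.hom.φ a) ≫ inj Y (f.hom.f a) ≫ g := by
  rw [← Category.assoc, inj_map, Category.assoc]

/-- Morphisms out of `Ψ X` are tested on the injections of terms. There `inj_delta`, `inj_map` and
`inj_eta` turn each axiom into the corresponding axiom for `F̂`, followed by a tensor product of
injections. -/
instance : Psi.OplaxMonoidal where
  η := etaIso.hom
  δ X Y := (deltaIso X Y).hom
  δ_natural_left {X Y} f Z := extend.hom_ext fun ⟨a, b⟩ => by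
    refine (inj_delta_assoc a b _).trans (Eq.symm ((inj_map_assoc (f ▷ Z) (a, b) _).trans ?_))
    refine (congrArg (_ ≫ ·) (inj_delta (f.hom.f a) b)).trans ?_
    refine (δ_natural_left_assoc FHatQ (f.hom.φ a) (Z.obj.obj b) _).symm.trans ?_
    rw [tensorHom_comp_whiskerRight, inj_map, whiskerRight_comp_tensorHom]
  δ_natural_right {X Y} Z f := extend.hom_ext fun ⟨b, a⟩ => by
    refine (inj_delta_assoc b a _).trans (Eq.symm ((inj_map_assoc (Z ◁ f) (b, a) _).trans ?_))
    refine (congrArg (_ ≫ ·) (inj_delta b (f.hom.f a))).trans ?_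
    refine (δ_natural_right_assoc FHatQ (Z.obj.obj b) (f.hom.φ a) _).symm.trans ?_
    rw [tensorHom_comp_whiskerLeft, inj_map, whiskerLeft_comp_tensorHom]
  oplax_associativity X Y Z := extend.hom_ext fun ⟨⟨a, b⟩, c⟩ => by
    refine (inj_delta_assoc (X := X ⊗ Y) (a, b) c _).trans
      (Eq.symm ((inj_map_assoc (α_ X Y Z).hom ((a, b), c) _).trans ?_))
    refine (congrArg (_ ≫ ·) (inj_delta_assoc (Y := Y ⊗ Z) a (b, c) _)).trans ?_
    rw [tensorHom_comp_whiskerLeft, tensorHom_comp_whiskerRight_assoc, inj_delta, inj_delta,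
      ← whiskerLeft_comp_tensorHom, ← whiskerRight_comp_tensorHom, Category.assoc,
      associator_naturality]
    refine (associativity_assoc FHatQ (X.obj.obj a) (Y.obj.obj b) (Z.obj.obj c) _).symm
  oplax_left_unitality X := by
    rw [← cancel_mono (λ_ _).hom, Iso.inv_hom_id]
    refine extend.hom_ext fun a => ?_
    simp only [Category.assoc]
    refine (Category.comp_id _).trans (Eq.symm ((inj_map_assoc (λ_ X).inv a _).trans ?_))
    refine (congrArg (_ ≫ ·) (inj_delta_assoc (X := 𝟙_ _) () a _)).trans ?_
    rw [tensorHom_comp_whiskerRight_assoc, inj_eta]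
    exact map_leftUnitor_inv_delta _ _
  oplax_right_unitality X := by
    rw [← cancel_mono (ρ_ _).hom, Iso.inv_hom_id]
    refine extend.hom_ext fun a => ?_
    simp only [Category.assoc]
    refine (Category.comp_id _).trans (Eq.symm ((inj_map_assoc (ρ_ X).inv a _).trans ?_))
    refine (congrArg (_ ≫ ·) (inj_delta_assoc (Y := 𝟙_ _) a () _)).trans ?_
    rw [tensorHom_comp_whiskerLeft_assoc, inj_eta]
    exact map_rightUnitor_inv_delta _ _

instance : IsIso (η Psi) := inferInstanceAs (IsIso etaIso.hom)

instance (X Y : FinCoprod (Fwm (Discrete FdHilb))) : IsIso (δ Psi X Y) :=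
  inferInstanceAs (IsIso (deltaIso X Y).hom)

theorem nonempty_braided : Nonempty Psi.Braided :=
  nonempty_braided_of_oplax Psi fun X Y => extend.hom_ext fun ⟨a, b⟩ => by
    refine (inj_delta_assoc a b _).trans (Eq.symm ((inj_map_assoc (β_ X Y).hom (a, b) _).trans ?_))
    refine (congrArg (_ ≫ ·) (inj_delta b a)).trans ?_
    rw [BraidedCategory.braiding_naturality]
    refine (Category.assoc _ _ _).symm.trans (Eq.trans ?_ (Category.assoc _ _ _))
    exact congrArg (· ≫ (inj Y b ⊗ₘ inj X a)) (FHatQ.delta_braiding _ _).symm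

/-- The unitary `V ⊗ ℂ ≅ V`. -/
def tensOne (V : FdHilb) : tens (n := 1) (fun _ => V) ≃ₗᵢ[ℂ] V := TensorProduct.ridIsometry ℂ V

/-- The family of one-term sequences `(V_i)` is sent to `(V_i ⊗ ℂ)`, because the tensor product of a
sequence ends in a factor `ℂ`. -/
instance : Psi.EssSurj where
  mem_essImage Y :=
    ⟨⟨⟨Y.idx, fun i => (Fwm.incl _).obj ⟨Y.sp i⟩⟩, inferInstanceAs (Finite Y.idx)⟩,
      ⟨Q.reindexIso (X := Psi.obj _) (Equiv.refl Y.idx) fun i => tensOne (Y.sp i)⟩⟩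

end Psi

/-! ### The two extension isomorphisms and the main theorem. -/

/-- A unitary induces an isomorphism in `Q'ₛ`. -/
def QsPrime.isoOfUnitary {V W : FdHilb} (u : V ≃ₗᵢ[ℂ] W) : QsPrime.mk V ≅ QsPrime.mk W where
  hom := show QsPrime.Hom ⟨V⟩ ⟨W⟩ from ⟨conjU u, IsCP.conjU u, fun ρ _ => trace_conjU u ρ⟩
  inv := show QsPrime.Hom ⟨W⟩ ⟨V⟩ from
    ⟨conjU u.symm, IsCP.conjU u.symm, fun ρ _ => trace_conjU u.symm ρ⟩
  hom_inv_id := QsPrime.Hom.ext (LinearMap.ext fun ρ => Q.conjU_symm u ρ)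
  inv_hom_id := QsPrime.Hom.ext (LinearMap.ext fun ρ => Q.conjU_symm' u ρ)

/-- `F̂` extends the identity-on-objects functor. -/
def inclCompFHatIso :
    Fwm.incl (Discrete FdHilb) ⋙ FHat ≅ Discrete.functor QsPrime.mk :=
  Discrete.natIso fun V => QsPrime.isoOfUnitary (Psi.tensOne V.as)

/-- `Ψ` extends `F̂`. -/
def inclCompPsiIso : FinCoprod.incl (Fwm (Discrete FdHilb)) ⋙ Psi ≅ FHatQ :=
  (NatIso.ofComponents (F := FHatQ) (G := FinCoprod.incl (Fwm (Discrete FdHilb)) ⋙ Psi)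
    (fun X =>
      -- A coproduct of a single term is that term: its injection is inverse to the morphism induced
      -- by the identity.
      { hom := Psi.inj ((FinCoprod.incl _).obj X) PUnit.unit
        inv := extend.desc (X := (FinCoprod.incl _).obj X) FHat fun _ => 𝟙 (FHatQ.obj X)
        hom_inv_id := extend.inj_desc _ _
        inv_hom_id := extend.hom_ext fun _ => (Category.assoc _ _ _).symm.trans
          ((congrArg (· ≫ _) (extend.inj_desc _ _)).trans
            ((Category.id_comp _).trans (Category.comp_id _).symm)) })
    fun f => (Psi.inj_map ((FinCoprod.incl _).map f) PUnit.unit).symm).symm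

end QModel

end

theorem mainTheorem2 :
    Nonempty (QModel.Fwm.incl (Discrete QModel.FdHilb) ⋙ QModel.FHat ≅
      Discrete.functor QModel.QsPrime.mk) ∧
    Nonempty (QModel.FHat ⋙ QModel.QsPrime.toQ).Braided ∧
    Nonempty (QModel.FinCoprod.incl (QModel.Fwm (Discrete QModel.FdHilb)) ⋙ QModel.Psi ≅
      QModel.FHat ⋙ QModel.QsPrime.toQ) ∧
    QModel.ModelHypotheses
      (QModel.finSetFunctor (QModel.Fwm (Discrete QModel.FdHilb))) QModel.Psi
      (QModel.finiteProductCones QModel.Qᵒᵖ) := by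
  refine ⟨⟨QModel.inclCompFHatIso⟩, QModel.FHatQ.nonempty_braided, ⟨QModel.inclCompPsiIso⟩, ?_⟩
  obtain ⟨hΦ⟩ := QModel.nonempty_braided_finSetFunctor
    (QModel.Fwm.isTerminalUnit (α := QModel.FdHilb))
  obtain ⟨hΨ⟩ := QModel.Psi.nonempty_braided
  have := QModel.full_finSetFunctor (QModel.Fwm.isTerminalUnit (α := QModel.FdHilb))
  have hC := QModel.FinCoprod.tensorDistributes (C := QModel.Fwm (Discrete QModel.FdHilb))
  have : PreservesFiniteCoproducts QModel.Psi :=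
    inferInstanceAs (PreservesFiniteCoproducts (QModel.extend QModel.FHat))
  -- This uses the strong monoidal structure `hΨ` as an instance; distributivity for finite sets
  -- uses `hΦ` in the same way.
  have hD := QModel.tensorDistributes_of_essSurj QModel.Psi hC
  exact
    { finiteProducts := inferInstance
      coproducts_B := inferInstance
      coproducts_C := inferInstance
      coproducts_D := QModel.hasFiniteCoproducts_of_essSurj QModel.Psi
      distributive_B := QModel.tensorDistributes_of_fullyFaithful
        (QModel.finSetFunctor (QModel.Fwm (Discrete QModel.FdHilb))) hC
      distributive_C := hC
      distributive_D := hD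
      affine := ⟨QModel.FinCoprod.isTerminalUnit QModel.Fwm.isTerminalUnit⟩
      strongMonoidal_Φ := ⟨hΦ⟩
      strongMonoidal_Ψ := ⟨hΨ⟩
      preservesCoproducts_Φ := inferInstance
      preservesCoproducts_Ψ := inferInstance
      full := inferInstance
      faithful := inferInstance
      essSurj := inferInstance
      multiplicativeKernel := QModel.Fwm.multiplicativeKernel_finSetFunctor
      preservedByOpTensor := QModel.preservedByOpTensor_finiteProductCones hD
      -- The class `Γ` is taken to be exactly the finite product cones.
      finiteProductCones_subset := fun _ _ _ _ h => h }
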